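/- Let $\mathbb F$ be $\mathbb R$ or $\mathbb C$ and $m\ge 1$. Put $d_{\mathbb R^m}=\frac{m(m+1)}2-1$, $d_{\mathbb C^m}=m^2-1$, $k_{\mathbb R^m}=\frac m2+1$, $k_{\mathbb C^m}=m+1$. Definitions. Fix a linear isometry $\mathcal V$ from the real vector space of trace-zero Hermitian (symmetric if $\mathbb F=\mathbb R$) $m\times m$ matrices over $\mathbb F$ with inner product $\operatorname{tr}(AB)$ onto $\mathbb R^{d_{\mathbb F^m}}$. The embedded vector of an orthogonal projection $P$ on $\mathbb F^m$ of rank $l$, $0<l<m$, is $v_P=\mathcal V\bigl(P-\tfrac lm I_m\bigr)\big/\sqrt{l(m-l)/m}$. A finite family $\{P_i\}$ of orthogonal projections on $\mathbb F^m$ is of constant rank if exactly one rank occurs in it; it is a fusion frame if $\sum_i P_i$ is positive definite; it is a maximal orthoplectic fusion frame for $\mathbb F^m$ if it consists of $2d_{\mathbb F^m}$ projections and its embedded vectors form an orthoplex in $\mathbb R^{d_{\mathbb F^m}}$, that is, they are the vectors of an orthonormal basis together with their negatives. A family $\{\mathcal B_k\}_{k\in K}$ of orthonormal bases of $\mathbb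 F^m$ is a set of mutually unbiased bases (MUBs) if $|\langle b,b'\rangle|^2=\frac1m$ for all $b\in\mathcal B_k$, $b'\in\mathcal B_{k'}$, $k\ne k'$; it is maximal if $|K|=k_{\mathbb F^m}$. For an orthonormal basis $\mathcal B=\{b_j\}_{j=1}^m$ and $\mathcal J\subseteq[m]=\{1,\dots,m\}$, the coordinate projection is $P^{\mathcal B}_{\mathcal J}=\sum_{j\in\mathcal J}b_jb_j^*$. A Hadamard 3-design on $[m]$ is a set $\mathbb S$ of subsets (blocks) of $[m]$ such that for some integer $t\ge1$: $m=4t$, every block has $2t$ elements, every 3-subset of $[m]$ lies in exactly $t-1$ blocks, every point lies in the same number of blocks, and $|\mathbb S|=8t-2$ (the last condition is automatic if $t\ge2$; if $t=1$, it says that $\mathbb S$ consists of all 2-subsets of $[4]$). Theorem. Let $\mathbb S$ be a set of subsets of $[m]$, each of size $l$, let $\{\mathcal B_k\}_{k\in K}$ be a maximal set of MUBs for $\mathbb F^m$, and let $\mathcal P=\{P^{\mathcal B_k}_{\mathcal J}: k\in K,\ \mathcal J\in\mathbb S\}$. If $\mathbb S$ is a Hadamard 3-design, then $\mathcal P$ is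 a maximal orthoplectic fusion frame of constant rank for $\mathbb F^m$ (in particular, a fusion frame). Conversely, if $m>2$ and $\mathcal P$ is a maximal orthoplectic fusion frame of constant rank for $\mathbb F^m$, then $\mathbb S$ is a Hadamard 3-design. In particular: 1. If $m\ge4$ is a power of $2$, then Hadamard 3-designs on $[m]$ exist, and there is a maximal set of MUBs for $\mathbb C^m$ such that for every Hadamard 3-design $\mathbb S$ on $[m]$ the family $\mathcal P$ is a maximal orthoplectic fusion frame of constant rank for $\mathbb C^m$. 2. If $m\ge4$ is a power of $4$, then Hadamard 3-designs on $[m]$ exist, and there is a maximal set of MUBs for $\mathbb R^m$ such that for every Hadamard 3-design $\mathbb S$ on $[m]$ the family $\mathcal P$ is a maximal orthoplectic fusion frame of constant rank for $\mathbb R^m$. -/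

import Mathlib

open scoped ComplexOrder

noncomputable section

namespace OrthoplecticFrames

/-! ### Packings of orthogonal projections -/

/-- The orthogonal projections on `𝕜 ^ m`, as Hermitian idempotent `m × m` matrices. -/
abbrev OrthProj (𝕜 : Type*) [RCLike 𝕜] (m : ℕ) : Type _ :=
  {P : Matrix (Fin m) (Fin m) 𝕜 // IsStarProjection P}

/-- A packing is a finite family `P : ι → OrthProj 𝕜 m`; its mixture is the number of different
ranks that occur. -/
def mixture {𝕜 : Type*} [RCLike 𝕜] {m : ℕ} {ι : Type*} [Fintype ι] (P : ι → OrthProj 𝕜 m) : ℕ :=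
  (Finset.univ.image fun i => (P i).1.rank).card

/-- A packing is of constant rank if exactly one rank occurs. -/
def IsConstantRank {𝕜 : Type*} [RCLike 𝕜] {m : ℕ} {ι : Type*} [Fintype ι]
    (P : ι → OrthProj 𝕜 m) : Prop :=
  mixture P = 1

/-- A packing is a fusion frame if its fusion frame operator `∑ i, P i` is positive definite. -/
def IsFusionFrame {𝕜 : Type*} [RCLike 𝕜] {m : ℕ} {ι : Type*} [Fintype ι]
    (P : ι → OrthProj 𝕜 m) : Prop :=
  (∑ i, (P i).1).PosDef

/-! ### The embedding of projections into a Euclidean sphere -/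

/-- The dimension `m (m + 1) / 2 - 1` over the reals and `m ^ 2 - 1` over the complex numbers.
(Up to isomorphism these are the only two instances of `RCLike`; the real dimension of `𝕜` tells
them apart.) -/
def embDim (𝕜 : Type*) [RCLike 𝕜] (m : ℕ) : ℕ :=
  if Module.finrank ℝ 𝕜 = 1 then m * (m + 1) / 2 - 1 else m ^ 2 - 1

theorem embDim_real (m : ℕ) : embDim ℝ m = m * (m + 1) / 2 - 1 := by
  simp [embDim]

theorem embDim_complex (m : ℕ) : embDim ℂ m = m ^ 2 - 1 := by
  simp [embDim, Complex.finrank_real_complex]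

/-- The real vector space of trace-zero Hermitian (symmetric if `𝕜 = ℝ`) matrices. -/
def tracelessHermitian (𝕜 : Type*) [RCLike 𝕜] (m : ℕ) :
    Submodule ℝ (Matrix (Fin m) (Fin m) 𝕜) where
  carrier := {A | A.IsHermitian ∧ A.trace = 0}
  add_mem' := by
    rintro A B ⟨hA, hA'⟩ ⟨hB, hB'⟩
    exact ⟨hA.add hB, by rw [Matrix.trace_add, hA', hB', add_zero]⟩
  zero_mem' := ⟨Matrix.isHermitian_zero, Matrix.trace_zero _ _⟩
  smul_mem' := by
    rintro c A ⟨hA, hA'⟩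
    refine ⟨?_, by rw [Matrix.trace_smul, hA', smul_zero]⟩
    rw [Matrix.IsHermitian, Matrix.conjTranspose_smul, hA.eq, star_trivial]

theorem trace_eq_rank {𝕜 : Type*} [RCLike 𝕜] {m : ℕ} (P : OrthProj 𝕜 m) :
    P.1.trace = (P.1.rank : 𝕜) := by
  have h : IsIdempotentElem (Matrix.toLin' P.1) := by
    have h0 : P.1 * P.1 = P.1 := P.2.isIdempotentElem
    rw [IsIdempotentElem, Module.End.mul_eq_comp, ← Matrix.toLin'_mul, h0]
  have h2 := (LinearMap.IsIdempotentElem.isProj_range _ h).trace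
  rw [Matrix.trace_toLin'_eq] at h2
  exact h2

/-- The traceless map `P ↦ P - (l / m) I`, where `l` is the rank of `P`. -/
def tracelessMap {𝕜 : Type*} [RCLike 𝕜] {m : ℕ} (P : OrthProj 𝕜 m) : tracelessHermitian 𝕜 m :=
  ⟨P.1 - ((P.1.rank : ℝ) / m) • (1 : Matrix (Fin m) (Fin m) 𝕜), by
    refine ⟨?_, ?_⟩
    · have h1 : P.1.IsHermitian := P.2.isSelfAdjoint
      refine h1.sub ?_
      rw [Matrix.IsHermitian, Matrix.conjTranspose_smul, Matrix.conjTranspose_one, star_trivial]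
    · rw [Matrix.trace_sub, trace_eq_rank, Matrix.trace_smul, Matrix.trace_one, Fintype.card_fin]
      rcases Nat.eq_zero_or_pos m with rfl | hm
      · have h0 : P.1.rank = 0 := by
          have := P.1.rank_le_card_width
          simpa using this
        simp [h0]
      · have hm' : (m : 𝕜) ≠ 0 := by exact_mod_cast hm.ne'
        rw [RCLike.real_smul_eq_coe_mul]
        push_cast
        field_simp
        ring⟩

/-- A linear identification of the trace-zero Hermitian matrices with a Euclidean space that takes
the Hilbert-Schmidt inner product `tr (A B)` to the Euclidean one. -/
def IsHilbertSchmidtIsometry {𝕜 : Type*} [RCLike 𝕜] {m d : ℕ}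
    (V : tracelessHermitian 𝕜 m ≃ₗ[ℝ] EuclideanSpace ℝ (Fin d)) : Prop :=
  ∀ A B : tracelessHermitian 𝕜 m, inner ℝ (V A) (V B) = RCLike.re (A.1 * B.1).trace

/-- The embedded vector of a projection `P` of rank `l`: the image of `P - (l / m) I`, divided by
its Hilbert-Schmidt norm `√(l (m - l) / m)`. -/
def embeddedVector {𝕜 : Type*} [RCLike 𝕜] {m d : ℕ}
    (V : tracelessHermitian 𝕜 m ≃ₗ[ℝ] EuclideanSpace ℝ (Fin d)) (P : OrthProj 𝕜 m) :
    EuclideanSpace ℝ (Fin d) :=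
  (Real.sqrt ((P.1.rank : ℝ) * ((m : ℝ) - P.1.rank) / m))⁻¹ • V (tracelessMap P)

/-- A family of vectors forms an orthoplex in `ℝ ^ d` if its members are exactly the vectors of an
orthonormal basis and their negatives. -/
def FormsOrthoplex {d : ℕ} {ι : Type*} (v : ι → EuclideanSpace ℝ (Fin d)) : Prop :=
  ∃ e : OrthonormalBasis (Fin d) ℝ (EuclideanSpace ℝ (Fin d)),
    Set.range v = Set.range (fun j => e j) ∪ Set.range (fun j => -e j)

/-- Maximal orthoplectic fusion frames: packings of `2 d` projections, `d = embDim 𝕜 m`, whose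
embedded vectors form an orthoplex in `ℝ ^ d`. (Two identifications `V` differ by an orthogonal
transformation of `ℝ ^ d`, so the choice of `V` is immaterial.) -/
def IsMaximalOrthoplectic {𝕜 : Type*} [RCLike 𝕜] {m : ℕ} {ι : Type*} [Fintype ι]
    (P : ι → OrthProj 𝕜 m) : Prop :=
  Fintype.card ι = 2 * embDim 𝕜 m ∧
    ∃ V : tracelessHermitian 𝕜 m ≃ₗ[ℝ] EuclideanSpace ℝ (Fin (embDim 𝕜 m)),
      IsHilbertSchmidtIsometry V ∧ FormsOrthoplex fun i => embeddedVector V (P i)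

/-! ### Mutually unbiased bases and coordinate projections -/

/-- A family of orthonormal bases of `𝕜 ^ m` is mutually unbiased. -/
def IsMUB {𝕜 : Type*} [RCLike 𝕜] {m : ℕ} {K : Type*}
    (B : K → OrthonormalBasis (Fin m) 𝕜 (EuclideanSpace 𝕜 (Fin m))) : Prop :=
  ∀ k k' : K, k ≠ k' → ∀ j j' : Fin m, ‖inner 𝕜 (B k j) (B k' j')‖ ^ 2 = 1 / (m : ℝ)

/-- The cardinality of a maximal set of mutually unbiased bases: `m / 2 + 1` over the reals and
`m + 1` over the complex numbers (a rational number, since `m` may be odd). -/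
def maxMUB (𝕜 : Type*) [RCLike 𝕜] (m : ℕ) : ℚ :=
  if Module.finrank ℝ 𝕜 = 1 then (m : ℚ) / 2 + 1 else (m : ℚ) + 1

theorem maxMUB_real (m : ℕ) : maxMUB ℝ m = (m : ℚ) / 2 + 1 := by
  simp [maxMUB]

theorem maxMUB_complex (m : ℕ) : maxMUB ℂ m = (m : ℚ) + 1 := by
  simp [maxMUB, Complex.finrank_real_complex]

/-- The matrix `∑ j ∈ J, b j (b j)^*`. -/
def coordMatrix {𝕜 : Type*} [RCLike 𝕜] {m : ℕ}
    (b : OrthonormalBasis (Fin m) 𝕜 (EuclideanSpace 𝕜 (Fin m))) (J : Finset (Fin m)) :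
    Matrix (Fin m) (Fin m) 𝕜 :=
  ∑ j ∈ J, Matrix.vecMulVec (WithLp.ofLp (b j)) (star (WithLp.ofLp (b j)))

theorem coordMatrix_isStarProjection {𝕜 : Type*} [RCLike 𝕜] {m : ℕ}
    (b : OrthonormalBasis (Fin m) 𝕜 (EuclideanSpace 𝕜 (Fin m))) (J : Finset (Fin m)) :
    IsStarProjection (coordMatrix b J) := by
  have hb : ∀ i j : Fin m,
      star (WithLp.ofLp (b i)) ⬝ᵥ WithLp.ofLp (b j) = if i = j then (1 : 𝕜) else 0 := by
    intro i j
    rw [dotProduct_comm, ← EuclideanSpace.inner_eq_star_dotProduct]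
    exact orthonormal_iff_ite.mp b.orthonormal i j
  refine ⟨?_, ?_⟩
  · unfold IsIdempotentElem coordMatrix
    rw [Finset.sum_mul]
    refine Finset.sum_congr rfl fun i hi => ?_
    rw [Finset.mul_sum, Finset.sum_eq_single i]
    · rw [Matrix.vecMulVec_mul_vecMulVec, hb, if_pos rfl, one_smul]
    · intro j _ hj
      rw [Matrix.vecMulVec_mul_vecMulVec, hb, if_neg hj.symm, zero_smul]
      ext; simp [Matrix.vecMulVec]
    · exact fun h => absurd hi h
  · unfold IsSelfAdjoint coordMatrix
    rw [star_sum]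
    refine Finset.sum_congr rfl fun i _ => ?_
    rw [Matrix.star_eq_conjTranspose, Matrix.conjTranspose_vecMulVec, star_star]

/-- The `J`-coordinate projection with respect to the orthonormal basis `b`. -/
def coordProj {𝕜 : Type*} [RCLike 𝕜] {m : ℕ}
    (b : OrthonormalBasis (Fin m) 𝕜 (EuclideanSpace 𝕜 (Fin m))) (J : Finset (Fin m)) :
    OrthProj 𝕜 m :=
  ⟨coordMatrix b J, coordMatrix_isStarProjection b J⟩

/-- The packing of all coordinate projections onto blocks `J ∈ S` with respect to the bases
`B k`. -/
def coordPacking {𝕜 : Type*} [RCLike 𝕜] {m : ℕ} {K : Type*}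
    (B : K → OrthonormalBasis (Fin m) 𝕜 (EuclideanSpace 𝕜 (Fin m)))
    (S : Finset (Finset (Fin m))) : K × S → OrthProj 𝕜 m :=
  fun p => coordProj (B p.1) p.2.1

/-! ### Block designs -/

/-- `S` is the set of blocks of a `t`-`(m, l, lam)` block design: all blocks have `l` elements,
every `t`-subset of the points lies in exactly `lam` blocks, and every point lies in the same
number of blocks. -/
def IsBlockDesign {m : ℕ} (t l lam : ℕ) (S : Finset (Finset (Fin m))) : Prop :=
  (∀ J ∈ S, J.card = l) ∧
    (∀ T : Finset (Fin m), T.card = t → (S.filter fun J => T ⊆ J).card = lam) ∧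
    ∃ r : ℕ, ∀ x : Fin m, (S.filter fun J => x ∈ J).card = r

/-- Hadamard 3-designs: `3`-`(4 t, 2 t, t - 1)` block designs with `8 t - 2` blocks, `t ≥ 1`.
For `t ≥ 2` the number of blocks follows from the other parameters. For `t = 1` it does not, as
`lam = 0`, and it singles out the set of all 2-subsets of a 4-set, which is the design that comes
from a Hadamard matrix of order 4. -/
def IsHadamardThreeDesign {m : ℕ} (S : Finset (Finset (Fin m))) : Prop :=
  ∃ t : ℕ, 1 ≤ t ∧ m = 4 * t ∧ IsBlockDesign 3 (2 * t) (t - 1) S ∧ S.card = 8 * t - 2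

end OrthoplecticFrames

end

open OrthoplecticFrames

/-! For projections of equal rank l, the inner product of embedded vectors is an affine function of
tr(PQ). If P and Q are coordinate projections for two unbiased bases, tr(PQ) = l²/m and the vectors
are orthogonal. For a common basis, tr(PQ) = |J ∩ J'|. So the question reduces to the intersection
numbers of the blocks within one basis, together with the count |K| (2m - 2) = 2d for a maximal set
of MUBs (`card_mul_eq_two_mul_embDim`).

The combinatorial core is that, for m = 4t and 8t - 2 blocks of size 2t, being a Hadamard 3-design
means being closed under complements, with blocks neither equal nor complementary meeting in t
points. From design to intersections (`card_inter_of_isBlockDesign`), a cubic moment of |J ∩ J'|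
leaves only the values 0 and t for J' ≠ J. Conversely (`isHadamardThreeDesign_of_inter`), the Gram
matrix of the ±1 incidence rows determines that of the columns, and complementation kills the odd
moments.

For a design, the inner products are therefore 1, -1 and 0, and one block from each complementary
pair in every basis yields an orthonormal basis. For an orthoplex, the antipode of each vector must
come from the same basis; this forces m = 2l and complementary blocks, and the remaining pairs are
orthogonal.

Existence: affine hyperplanes over the field with two elements form a Hadamard 3-design. MUBs come
from families of symmetric bilinear forms over that field with nondegenerate differences, through
quadratic phase functions and their Gauss sums (`exists_isMUB_of_forms`). Trace forms serve the
complex case; the real case needs alternating forms, supplied by a Kerdock set. -/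

namespace OrthoplecticFrames

/-! ### Sign vectors: from intersection numbers to designs -/

/-- The `±1`-valued indicator of a finite set. -/
def signOf {α : Type*} [DecidableEq α] (J : Finset α) (x : α) : ℤ := if x ∈ J then 1 else -1

section signOf

variable {α : Type*} [DecidableEq α]

theorem signOf_mul_self (J : Finset α) (x : α) : signOf J x * signOf J x = 1 := by
  unfold signOf; split_ifs <;> simp

variable [Fintype α]

theorem signOf_compl (J : Finset α) (x : α) : signOf Jᶜ x = -signOf J x := by
  unfold signOf; by_cases h : x ∈ J <;> simp [h]

theorem sum_signOf (J : Finset α) : ∑ x, signOf J x = 2 * J.card - Fintype.card α := by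
  have h : ∀ x, signOf J x = 2 * (if x ∈ J then 1 else 0) - 1 := fun x => by
    unfold signOf; split_ifs <;> simp
  simp only [h, Finset.sum_sub_distrib, ← Finset.mul_sum]
  simp

theorem sum_signOf_mul_signOf (J J' : Finset α) :
    ∑ x, signOf J x * signOf J' x =
      Fintype.card α - 2 * J.card - 2 * J'.card + 4 * (J ∩ J').card := by
  have h : ∀ x, signOf J x * signOf J' x = 1 - 2 * (if x ∈ J then 1 else 0)
      - 2 * (if x ∈ J' then 1 else 0) + 4 * (if x ∈ J ∩ J' then 1 else 0) := fun x => by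
    unfold signOf
    by_cases h : x ∈ J <;> by_cases h' : x ∈ J' <;> simp [h, h']
  simp only [h, Finset.sum_sub_distrib, Finset.sum_add_distrib, ← Finset.mul_sum,
    Finset.sum_ite_mem, Finset.univ_inter, Finset.sum_const, Finset.card_univ, mul_one, nsmul_eq_mul]

/-- A sum over a complement-closed set of blocks of an odd function vanishes. -/
theorem sum_eq_zero_of_odd {S : Finset (Finset α)} (hS : ∀ J ∈ S, Jᶜ ∈ S) (f : Finset α → ℤ)
    (hf : ∀ J, f Jᶜ = -f J) : ∑ J ∈ S, f J = 0 := by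
  have h : ∑ J ∈ S, f J = ∑ J ∈ S, -f J :=
    Finset.sum_nbij' (fun J => Jᶜ) (fun J => Jᶜ) hS hS (fun J _ => compl_compl J)
      (fun J _ => compl_compl J) (fun J _ => by rw [hf, neg_neg])
  rw [Finset.sum_neg_distrib] at h
  omega

end signOf

/-- A complement-closed set of `2 m - 2` halves of an `m`-set whose members are pairwise equal,
complementary or orthogonal has orthogonal columns, apart from the constant row. -/
theorem sum_signOf_mul_signOf_blocks {m t : ℕ} (hm : m = 4 * t) (ht : 1 ≤ t)
    {S : Finset (Finset (Fin m))} (hcompl : ∀ J ∈ S, Jᶜ ∈ S) (hcard : ∀ J ∈ S, J.card = 2 * t)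
    (hinter : ∀ J ∈ S, ∀ J' ∈ S, J' ≠ J → J' ≠ Jᶜ → (J ∩ J').card = t)
    (hS : S.card = 8 * t - 2) {x y : Fin m} (hxy : x ≠ y) :
    ∑ J ∈ S, signOf J x * signOf J y = -2 := by
  set G : Fin m → Fin m → ℤ := fun x y => ∑ J ∈ S, signOf J x * signOf J y with hG
  have hS' : (S.card : ℤ) = 2 * m - 2 := by omega
  have hrow : ∀ J ∈ S, ∑ x, signOf J x = 0 := fun J hJ => by
    rw [sum_signOf, hcard J hJ, Fintype.card_fin, hm]; push_cast; ring
  have hne : ∀ J ∈ S, Jᶜ ≠ J := fun J hJ h => by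
    obtain ⟨x, hx⟩ : J.Nonempty := by
      rw [← Finset.card_pos, hcard J hJ]; omega
    have hx' : x ∈ Jᶜ := by rw [h]; exact hx
    exact Finset.mem_compl.1 hx' hx
  -- Only J and its complement contribute, m² each; all other rows are orthogonal to J.
  have hgram : ∀ J ∈ S, ∑ J' ∈ S, (∑ x, signOf J x * signOf J' x) ^ 2 = 2 * (m : ℤ) ^ 2 := by
    intro J hJ
    rw [← Finset.sum_subset (s₁ := {J, Jᶜ})]
    · rw [Finset.sum_pair (hne J hJ).symm]
      simp only [signOf_compl, mul_neg, Finset.sum_neg_distrib, signOf_mul_self]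
      simp; ring
    · intro J' hJ'
      rcases Finset.mem_insert.1 hJ' with rfl | h
      · exact hJ
      · rw [Finset.mem_singleton.1 h]; exact hcompl J hJ
    · intro J' hJ' hn
      simp only [Finset.mem_insert, Finset.mem_singleton, not_or] at hn
      rw [sum_signOf_mul_signOf, hcard J hJ, hcard J' hJ', hinter J hJ J' hJ' hn.1 hn.2,
        Fintype.card_fin, hm]
      push_cast; ring
  -- For the sign matrix A, the matrices AᵀA and AAᵀ have the same Frobenius norm.
  have hGG : ∑ x, ∑ y, G x y ^ 2 = (2 * m - 2) * (2 * (m : ℤ) ^ 2) := by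
    calc ∑ x, ∑ y, G x y ^ 2
        = ∑ x, ∑ y, ∑ J ∈ S, ∑ J' ∈ S, (signOf J x * signOf J' x) * (signOf J y * signOf J' y) := by
          refine Finset.sum_congr rfl fun x _ => Finset.sum_congr rfl fun y _ => ?_
          rw [hG, pow_two, Finset.sum_mul_sum]
          refine Finset.sum_congr rfl fun J _ => Finset.sum_congr rfl fun J' _ => ?_
          ring
      _ = ∑ J ∈ S, ∑ J' ∈ S, ∑ x, ∑ y,
            (signOf J x * signOf J' x) * (signOf J y * signOf J' y) := by
          simp only [Finset.sum_comm (s := Finset.univ) (t := S)]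
      _ = ∑ J ∈ S, ∑ J' ∈ S, (∑ x, signOf J x * signOf J' x) ^ 2 := by
          refine Finset.sum_congr rfl fun J _ => Finset.sum_congr rfl fun J' _ => ?_
          rw [pow_two, Finset.sum_mul_sum]
      _ = _ := by
          rw [Finset.sum_congr rfl hgram, Finset.sum_const, nsmul_eq_mul, hS']
  have hG1 : ∑ x, ∑ y, G x y = 0 := by
    simp only [hG, Finset.sum_comm (s := Finset.univ) (t := S)]
    refine Finset.sum_eq_zero fun J hJ => ?_
    rw [← Finset.sum_mul_sum, hrow J hJ, zero_mul]
  have hGd : ∀ x, G x x = 2 * m - 2 := fun x => by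
    simp only [hG, signOf_mul_self]; simp [hS']
  -- The squared Frobenius distance from G to 2m times the identity minus twice the all-ones matrix
  -- depends only on the norm, the total and the diagonal of G.
  have hzero : ∑ x, ∑ y, (G x y + 2 - if x = y then 2 * (m : ℤ) else 0) ^ 2 = 0 := by
    have h : ∀ x y, (G x y + 2 - if x = y then 2 * (m : ℤ) else 0) ^ 2 =
        G x y ^ 2 + 4 * G x y + 4 - if x = y then 4 * (m : ℤ) * G x y + 8 * m - 4 * m ^ 2 else 0 := by
      intro x y; split_ifs <;> ring
    simp only [h, Finset.sum_sub_distrib, Finset.sum_add_distrib, ← Finset.mul_sum, hGG, hG1,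
      Finset.sum_ite_eq, Finset.mem_univ, if_true, hGd]
    simp
    ring
  rw [Finset.sum_eq_zero_iff_of_nonneg
    (fun _ _ => Finset.sum_nonneg fun _ _ => sq_nonneg _)] at hzero
  have h1 := hzero x (Finset.mem_univ x)
  rw [Finset.sum_eq_zero_iff_of_nonneg (fun _ _ => sq_nonneg _)] at h1
  have h2 := h1 y (Finset.mem_univ y)
  rw [if_neg hxy, sub_zero, sq_eq_zero_iff] at h2
  change G x y = -2
  omega

/-- A complement-closed set of `2 m - 2` halves of an `m`-set, `m = 4 t`, such that any two members
that are neither equal nor complementary meet in `t` points, is a Hadamard 3-design. -/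
theorem isHadamardThreeDesign_of_inter {m t : ℕ} (hm : m = 4 * t) (ht : 1 ≤ t)
    {S : Finset (Finset (Fin m))} (hcompl : ∀ J ∈ S, Jᶜ ∈ S) (hcard : ∀ J ∈ S, J.card = 2 * t)
    (hinter : ∀ J ∈ S, ∀ J' ∈ S, J' ≠ J → J' ≠ Jᶜ → (J ∩ J').card = t)
    (hS : S.card = 8 * t - 2) : IsHadamardThreeDesign S := by
  have hS' : (S.card : ℤ) = 8 * t - 2 := by omega
  have hodd : ∀ x, ∑ J ∈ S, signOf J x = 0 := fun x =>
    sum_eq_zero_of_odd hcompl _ fun J => signOf_compl J x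
  have hodd3 : ∀ x y z, ∑ J ∈ S, signOf J x * signOf J y * signOf J z = 0 := fun x y z =>
    sum_eq_zero_of_odd hcompl _ fun J => by simp only [signOf_compl]; ring
  refine ⟨t, ht, hm, ⟨hcard, fun T hT => ?_, 4 * t - 1, fun x => ?_⟩, hS⟩
  · obtain ⟨x, y, z, hxy, hxz, hyz, rfl⟩ := Finset.card_eq_three.1 hT
    -- Expansion of the product of the three factors 1 + sign. Summed over S, the odd terms vanish
    -- and each pair gives -2, so 8λ = (8t - 2) - 6.
    have h : ∀ J : Finset (Fin m), (8 * if {x, y, z} ⊆ J then 1 else 0 : ℤ) =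
        1 + signOf J x + signOf J y + signOf J z + signOf J x * signOf J y
          + signOf J x * signOf J z + signOf J y * signOf J z
          + signOf J x * signOf J y * signOf J z := fun J => by
      unfold signOf
      by_cases hx : x ∈ J <;> by_cases hy : y ∈ J <;> by_cases hz : z ∈ J <;>
        simp [hx, hy, hz, Finset.insert_subset_iff]
    have hsum := Finset.sum_congr rfl (fun J (_ : J ∈ S) => h J)
    simp only [Finset.sum_add_distrib, hodd, hodd3,
      sum_signOf_mul_signOf_blocks hm ht hcompl hcard hinter hS hxy,
      sum_signOf_mul_signOf_blocks hm ht hcompl hcard hinter hS hxz,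
      sum_signOf_mul_signOf_blocks hm ht hcompl hcard hinter hS hyz, ← Finset.mul_sum,
      Finset.sum_boole] at hsum
    simp at hsum
    omega
  · have h : ∀ J : Finset (Fin m), (2 * if x ∈ J then 1 else 0 : ℤ) = 1 + signOf J x := fun J => by
      unfold signOf; split_ifs <;> simp
    have hsum := Finset.sum_congr rfl (fun J (_ : J ∈ S) => h J)
    simp only [Finset.sum_add_distrib, hodd, ← Finset.mul_sum, Finset.sum_boole] at hsum
    simp at hsum
    omega

/-! ### Counting in Hadamard 3-designs: from designs to intersection numbers -/

/-- Double counting of the `i`-subsets of a set `A` that lie in blocks. -/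
theorem sum_choose_card_inter {α : Type*} [DecidableEq α] {S : Finset (Finset α)} {i lam : ℕ}
    (h : ∀ T : Finset α, T.card = i → (S.filter fun J => T ⊆ J).card = lam) (A : Finset α) :
    ∑ J ∈ S, (A ∩ J).card.choose i = A.card.choose i * lam := by
  have := Finset.sum_card_bipartiteAbove_eq_sum_card_bipartiteBelow
    (s := A.powersetCard i) (t := S) (fun T J => T ⊆ J)
  simp only [Finset.bipartiteAbove, Finset.bipartiteBelow] at this
  rw [Finset.sum_congr rfl (fun T hT => h T (Finset.mem_powersetCard.1 hT).2), Finset.sum_const,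
    Finset.card_powersetCard, smul_eq_mul] at this
  rw [this]
  refine Finset.sum_congr rfl fun J _ => ?_
  rw [← Finset.card_powersetCard]
  congr 1
  ext T
  simp only [Finset.mem_powersetCard, Finset.mem_filter, Finset.subset_inter_iff]
  tauto

/-- The blocks of a Hadamard 3-design through two points. -/
theorem card_filter_pair {m t : ℕ} (hm : m = 4 * t) (ht : 1 ≤ t) {S : Finset (Finset (Fin m))}
    (hS : IsBlockDesign 3 (2 * t) (t - 1) S) (hcard : S.card = 8 * t - 2) (T : Finset (Fin m))
    (hT : T.card = 2) : (S.filter fun J => T ⊆ J).card = 2 * t - 1 := by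
  rcases Nat.lt_or_ge 1 t with h1 | h1
  -- Extending T by a third point counts (4t - 2)(t - 1) = λ(2t - 2), which determines λ only for t
  -- > 1.
  · have hcount := Finset.sum_card_bipartiteAbove_eq_sum_card_bipartiteBelow
      (s := Tᶜ) (t := S.filter fun J => T ⊆ J) (fun x J => x ∈ J)
    have hl : ∀ x ∈ Tᶜ, (Finset.bipartiteAbove (fun x J => x ∈ J)
        (S.filter fun J => T ⊆ J) x).card = t - 1 := fun x hx => by
      rw [← hS.2.1 (insert x T) (by rw [Finset.card_insert_of_notMem (Finset.mem_compl.1 hx), hT]),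
        Finset.bipartiteAbove, Finset.filter_filter]
      congr 1
      ext J
      simp only [Finset.mem_filter, Finset.insert_subset_iff]
      tauto
    have hr : ∀ J ∈ S.filter fun J => T ⊆ J,
        (Finset.bipartiteBelow (fun x J => x ∈ J) Tᶜ J).card = 2 * t - 2 := fun J hJ => by
      rw [Finset.mem_filter] at hJ
      have : Finset.bipartiteBelow (fun x J => x ∈ J) Tᶜ J = J \ T := by
        ext x; simp [Finset.bipartiteBelow, and_comm]
      rw [this, Finset.card_sdiff_of_subset hJ.2, hS.1 J hJ.1, hT]
    rw [Finset.sum_congr rfl hl, Finset.sum_congr rfl hr, Finset.sum_const, Finset.sum_const,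
      Finset.card_compl, hT, Fintype.card_fin, smul_eq_mul, smul_eq_mul,
      show m - 2 = 2 * (2 * t - 1) by omega, show 2 * t - 2 = 2 * (t - 1) by omega] at hcount
    have hp : 0 < 2 * (t - 1) := by omega
    exact Nat.eq_of_mul_eq_mul_right hp (by rw [← hcount]; ring)
  · obtain rfl : t = 1 := by omega
    subst hm
    -- For t = 1 the count above is 0 = 0; instead, six blocks exhaust the 2-subsets of four points.
    have hall : S = Finset.univ.powersetCard 2 := by
      refine Finset.eq_of_subset_of_card_le (fun J hJ => ?_) ?_
      · rw [Finset.mem_powersetCard]; exact ⟨Finset.subset_univ _, hS.1 J hJ⟩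
      · rw [hcard, Finset.card_powersetCard]; decide
    have : (S.filter fun J => T ⊆ J) = {T} := by
      ext J
      simp only [hall, Finset.mem_filter, Finset.mem_powersetCard, Finset.subset_univ, true_and,
        Finset.mem_singleton]
      constructor
      · rintro ⟨h2, h3⟩
        exact (Finset.eq_of_subset_of_card_le h3 (by omega)).symm
      · rintro rfl
        exact ⟨hT, subset_rfl⟩
    rw [this]; simp

/-- The blocks of a Hadamard 3-design through a point. -/
theorem card_filter_point {m t : ℕ} (hm : m = 4 * t) (ht : 1 ≤ t) {S : Finset (Finset (Fin m))}
    (hS : IsBlockDesign 3 (2 * t) (t - 1) S) (hcard : S.card = 8 * t - 2) (x : Fin m) :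
    (S.filter fun J => x ∈ J).card = 4 * t - 1 := by
  obtain ⟨hl, -, r, hr⟩ := hS
  have hcount := sum_choose_card_inter (S := S) (i := 1) (lam := r) (fun T hT => by
    obtain ⟨x, rfl⟩ := Finset.card_eq_one.1 hT
    simpa using hr x) Finset.univ
  simp only [Finset.univ_inter, Nat.choose_one_right, Finset.card_univ, Fintype.card_fin] at hcount
  rw [Finset.sum_congr rfl hl, Finset.sum_const, smul_eq_mul, hcard, hm] at hcount
  rw [hr x]
  have e : 8 * t - 2 = 2 * (4 * t - 1) := by omega
  rw [e] at hcount
  have hp : 0 < 4 * t := by omega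
  exact Nat.eq_of_mul_eq_mul_left hp (by rw [← hcount]; ring)

/-- The cubic n(n - t)² is a combination of n, C(n,2) and C(n,3), whose sums over the blocks follow
from the numbers of blocks through one, two and three points. It is chosen to be nonnegative and to
vanish exactly at the wanted intersection numbers 0 and t. -/
theorem sum_card_inter_moments {m t : ℕ} (hm : m = 4 * t) (ht : 1 ≤ t)
    {S : Finset (Finset (Fin m))} (hS : IsBlockDesign 3 (2 * t) (t - 1) S)
    (hcard : S.card = 8 * t - 2) {J : Finset (Fin m)} (hJ : J ∈ S) :
    ∑ J' ∈ S, ((J ∩ J').card : ℤ) = 2 * t * (4 * t - 1) ∧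
    ∑ J' ∈ S, ((J ∩ J').card : ℤ) * (((J ∩ J').card : ℤ) - t) ^ 2 = 2 * t * t ^ 2 := by
  have hc : ∀ n : ℕ, (n : ℤ) * (n - 1) = 2 * (n.choose 2 : ℤ) := fun n => by
    induction n with
    | zero => simp
    | succ n ih => rw [Nat.choose_succ_succ' n 1]; push_cast; rw [Nat.choose_one_right]; linarith
  have hc3 : ∀ n : ℕ, (n : ℤ) * (n - 1) * (n - 2) = 6 * (n.choose 3 : ℤ) := fun n => by
    induction n with
    | zero => simp
    | succ n ih =>
      rw [Nat.choose_succ_succ' n 2]; push_cast; linarith [hc n]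
  have h1 := sum_choose_card_inter (S := S) (i := 1) (lam := 4 * t - 1) (fun T hT => by
    obtain ⟨x, rfl⟩ := Finset.card_eq_one.1 hT
    simpa using card_filter_point hm ht hS hcard x) J
  have h2 := sum_choose_card_inter (card_filter_pair hm ht hS hcard) J
  have h3 := sum_choose_card_inter hS.2.1 J
  rw [hS.1 J hJ] at h1 h2 h3
  simp only [Nat.choose_one_right] at h1
  zify [show 1 ≤ 4 * t by omega, show 1 ≤ 2 * t by omega, ht] at h1 h2 h3
  refine ⟨h1, ?_⟩
  have hexp : ∀ n : ℕ, (n : ℤ) * (n - t) ^ 2 =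
      6 * (n.choose 3 : ℤ) + (6 - 4 * t) * (n.choose 2 : ℤ) + (t - 1) ^ 2 * n := fun n => by
    linear_combination hc3 n + (3 - 2 * (t : ℤ)) * hc n
  simp only [hexp, Finset.sum_add_distrib, ← Finset.mul_sum, h1, h2, h3]
  have e2 := hc (2 * t)
  have e3 := hc3 (2 * t)
  push_cast at e2 e3
  linear_combination (-(t : ℤ) + 1) * e3 - (3 - 2 * (t : ℤ)) * (2 * t - 1) * e2

/-- Two blocks of a Hadamard 3-design are disjoint, equal or meet in `t` points. -/
theorem card_inter_of_isBlockDesign {m t : ℕ} (hm : m = 4 * t) (ht : 1 ≤ t)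
    {S : Finset (Finset (Fin m))} (hS : IsBlockDesign 3 (2 * t) (t - 1) S)
    (hcard : S.card = 8 * t - 2) {J : Finset (Fin m)} (hJ : J ∈ S) :
    Jᶜ ∈ S ∧ ∀ J' ∈ S, J' ≠ J → J' ≠ Jᶜ → (J ∩ J').card = t := by
  obtain ⟨h1, h3⟩ := sum_card_inter_moments hm ht hS hcard hJ
  rw [← Finset.add_sum_erase S _ hJ, Finset.inter_self, hS.1 J hJ] at h1 h3
  -- The term of J itself is 2t(2t - t)², already the whole cubic moment.
  have hz : ∑ J' ∈ S.erase J, ((J ∩ J').card : ℤ) * (((J ∩ J').card : ℤ) - t) ^ 2 = 0 := by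
    push_cast at h3; linear_combination h3
  rw [Finset.sum_eq_zero_iff_of_nonneg
    (fun _ _ => mul_nonneg (Int.natCast_nonneg _) (sq_nonneg _))] at hz
  have hval : ∀ J' ∈ S.erase J, (J ∩ J').card = 0 ∨ (J ∩ J').card = t := fun J' hJ' => by
    rcases mul_eq_zero.1 (hz J' hJ') with h | h
    · left; exact_mod_cast h
    · right; rw [sq_eq_zero_iff, sub_eq_zero] at h; exact_mod_cast h
  have hdisj : ∀ J' ∈ S, (J ∩ J').card = 0 → J' = Jᶜ := fun J' hJ' h0 => by
    refine Finset.eq_of_subset_of_card_le (fun x hx => ?_) ?_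
    · rw [Finset.mem_compl]
      intro hxJ
      have : x ∈ J ∩ J' := Finset.mem_inter.2 ⟨hxJ, hx⟩
      rw [Finset.card_eq_zero.1 h0] at this
      simp at this
    · rw [Finset.card_compl, Fintype.card_fin, hS.1 J hJ, hS.1 J' hJ']; omega
  refine ⟨?_, fun J' hJ' hne hnc => ?_⟩
  · by_contra hn
    -- Without the complement, the first moment would be 2t + (8t - 3)t instead of 2t(4t - 1), which
    -- forces t = 0.
    have hall : ∀ J' ∈ S.erase J, ((J ∩ J').card : ℤ) = t := fun J' hJ' => by
      rcases hval J' hJ' with h | h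
      · exact absurd (hdisj J' (Finset.mem_of_mem_erase hJ') h ▸ Finset.mem_of_mem_erase hJ') hn
      · exact_mod_cast h
    rw [Finset.sum_congr rfl hall, Finset.sum_const, Finset.card_erase_of_mem hJ, hcard,
      nsmul_eq_mul] at h1
    have : ((8 * t - 2 - 1 : ℕ) : ℤ) = 8 * t - 3 := by omega
    rw [this] at h1
    push_cast at h1
    have : (t : ℤ) = 0 := by linear_combination h1
    omega
  · rcases hval J' (Finset.mem_erase.2 ⟨hne, hJ'⟩) with h | h
    · exact absurd (hdisj J' hJ' h) hnc
    · exact h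

/-! ### The Hilbert-Schmidt isometry -/

theorem two_mul_card_lt_pairs (m : ℕ) :
    2 * Fintype.card {p : Fin m × Fin m // p.1 < p.2} = m * (m - 1) := by
  have h : Fintype.card {p : Fin m × Fin m // p.1 < p.2} = ∑ j : Fin m, (j : ℕ) := by
    rw [Fintype.card_subtype, Finset.card_filter, Fintype.sum_prod_type_right]
    refine Finset.sum_congr rfl fun j _ => ?_
    rw [← Finset.card_filter]
    have : (Finset.univ.filter fun i : Fin m => i < j) = Finset.Iio j := by ext; simp
    simp [this]
  rw [h, Fin.sum_univ_eq_sum_range (fun i => i), mul_comm, Finset.sum_range_id_mul_two]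

theorem finrank_real_eq_one_or_two (𝕜 : Type*) [RCLike 𝕜] :
    Module.finrank ℝ 𝕜 = 1 ∨ Module.finrank ℝ 𝕜 = 2 := by
  have h1 := RCLike.finrank_le_two (K := 𝕜)
  have h2 : 0 < Module.finrank ℝ 𝕜 := Module.finrank_pos
  omega

/-- The sum of coordinates as a linear functional. -/
def coordSum (m : ℕ) : (Fin m → ℝ) →ₗ[ℝ] ℝ := ∑ i, LinearMap.proj i

theorem finrank_ker_coordSum {m : ℕ} (hm : 0 < m) :
    Module.finrank ℝ (LinearMap.ker (coordSum m)) = m - 1 := by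
  have h := (coordSum m).finrank_range_add_finrank_ker
  have hs : LinearMap.range (coordSum m) = ⊤ := by
    rw [LinearMap.range_eq_top]
    intro c
    refine ⟨Pi.single ⟨0, hm⟩ c, ?_⟩
    simp [coordSum]
  rw [hs, finrank_top, Module.finrank_self, Module.finrank_fin_fun] at h
  omega

/-- A trace-zero Hermitian matrix is given by its entries above the diagonal and its real diagonal
entries. -/
def upperEntries (𝕜 : Type*) [RCLike 𝕜] (m : ℕ) : tracelessHermitian 𝕜 m →ₗ[ℝ]
    ({p : Fin m × Fin m // p.1 < p.2} → 𝕜) × LinearMap.ker (coordSum m) where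
  toFun A := (fun p => A.1 p.1.1 p.1.2, ⟨fun i => RCLike.re (A.1 i i), by
    have h := congrArg RCLike.re A.2.2
    rw [Matrix.trace, map_sum, map_zero] at h
    simpa [coordSum] using h⟩)
  map_add' A B := by
    ext <;> simp
  map_smul' c A := by
    ext <;> simp [RCLike.smul_re]

theorem upperEntries_bijective (𝕜 : Type*) [RCLike 𝕜] (m : ℕ) :
    Function.Bijective (upperEntries 𝕜 m) := by
  constructor
  · rw [injective_iff_map_eq_zero]
    intro A hA
    have h1 : ∀ i j : Fin m, i < j → A.1 i j = 0 := fun i j hij =>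
      congrFun (congrArg Prod.fst hA) ⟨(i, j), hij⟩
    have h2 : ∀ i : Fin m, RCLike.re (A.1 i i) = 0 := fun i =>
      congrFun (congrArg Subtype.val (congrArg Prod.snd hA)) i
    ext i j
    change A.1 i j = 0
    rcases lt_trichotomy i j with h | h | h
    · exact h1 i j h
    · subst h
      rw [← A.2.1.coe_re_apply_self i, h2, RCLike.ofReal_zero]
    · rw [← A.2.1.apply i j, h1 j i h, star_zero]
  · rintro ⟨u, d, hd⟩
    refine ⟨⟨Matrix.of fun i j => if h : i < j then u ⟨(i, j), h⟩ else
      if h : j < i then star (u ⟨(j, i), h⟩) else (d i : 𝕜), ?_, ?_⟩, ?_⟩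
    · ext i j
      rw [Matrix.conjTranspose_apply]
      rcases lt_trichotomy i j with h | h | h
      · simp [h, h.not_gt]
      · subst h; simp
      · simp [h, h.not_gt]
    · have : ∑ i, d i = 0 := by simpa [coordSum] using hd
      simp only [Matrix.trace, Matrix.diag_apply, Matrix.of_apply, lt_irrefl, dite_false]
      rw [← RCLike.ofReal_sum, this, RCLike.ofReal_zero]
    · ext p
      · simp [upperEntries, p.2]
      · simp [upperEntries]

theorem finrank_tracelessHermitian (𝕜 : Type*) [RCLike 𝕜] {m : ℕ} (hm : 0 < m) :
    Module.finrank ℝ (tracelessHermitian 𝕜 m) = embDim 𝕜 m := by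
  rw [(LinearEquiv.ofBijective _ (upperEntries_bijective 𝕜 m)).finrank_eq, Module.finrank_prod,
    finrank_ker_coordSum hm, Module.finrank_pi_fintype, Finset.sum_const, smul_eq_mul,
    Finset.card_univ, embDim]
  have h := two_mul_card_lt_pairs m
  obtain ⟨n, rfl⟩ : ∃ n, m = n + 1 := ⟨m - 1, by omega⟩
  rw [Nat.add_sub_cancel] at h
  rcases finrank_real_eq_one_or_two 𝕜 with h1 | h1
  · rw [if_pos h1, h1]
    have : (n + 1) * (n + 1 + 1) = (n + 1) * n + 2 * (n + 1) := by ring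
    omega
  · rw [if_neg (by omega), h1, pow_two]
    have : (n + 1) * (n + 1) = (n + 1) * n + (n + 1) := by ring
    omega

/-- The Hilbert-Schmidt inner product on the trace-zero Hermitian matrices. -/
@[reducible]
def hilbertSchmidtCore (𝕜 : Type*) [RCLike 𝕜] (m : ℕ) :
    InnerProductSpace.Core ℝ (tracelessHermitian 𝕜 m) where
  inner A B := RCLike.re (A.1 * B.1).trace
  conj_inner_symm A B := by
    rw [Matrix.trace_mul_comm]; rfl
  re_inner_nonneg A := by
    have h := (Matrix.posSemidef_conjTranspose_mul_self A.1).trace_nonneg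
    rw [A.2.1.eq] at h
    exact (RCLike.nonneg_iff.1 h).1
  add_left A B C := by
    simp [add_mul]
  smul_left A B c := by
    simp [RCLike.smul_re]
  definite A h := by
    have h0 := (Matrix.posSemidef_conjTranspose_mul_self A.1).trace_nonneg
    have h1 : (A.1.conjTranspose * A.1).trace = 0 := by
      rw [A.2.1.eq] at h0 ⊢
      exact RCLike.ext (by simpa using h) (by simpa using (RCLike.nonneg_iff.1 h0).2)
    exact Subtype.ext (Matrix.trace_conjTranspose_mul_self_eq_zero_iff.1 h1)

theorem exists_isHilbertSchmidtIsometry (𝕜 : Type*) [RCLike 𝕜] {m : ℕ} (hm : 0 < m) :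
    ∃ V : tracelessHermitian 𝕜 m ≃ₗ[ℝ] EuclideanSpace ℝ (Fin (embDim 𝕜 m)),
      IsHilbertSchmidtIsometry V := by
  let _ : NormedAddCommGroup (tracelessHermitian 𝕜 m) :=
    (hilbertSchmidtCore 𝕜 m).toNormedAddCommGroup
  let _ : InnerProductSpace ℝ (tracelessHermitian 𝕜 m) :=
    InnerProductSpace.ofCore (hilbertSchmidtCore 𝕜 m).toCore
  let b := (stdOrthonormalBasis ℝ (tracelessHermitian 𝕜 m)).reindex
    (finCongr (finrank_tracelessHermitian 𝕜 hm))
  exact ⟨b.repr.toLinearEquiv, fun A B => b.repr.inner_map_map A B⟩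

/-! ### Coordinate projections -/

theorem trace_coordMatrix_mul {𝕜 : Type*} [RCLike 𝕜] {m : ℕ}
    (b b' : OrthonormalBasis (Fin m) 𝕜 (EuclideanSpace 𝕜 (Fin m))) (J J' : Finset (Fin m)) :
    RCLike.re (coordMatrix b J * coordMatrix b' J').trace =
      ∑ i ∈ J, ∑ j ∈ J', ‖inner 𝕜 (b i) (b' j)‖ ^ 2 := by
  unfold coordMatrix
  rw [Finset.sum_mul, Matrix.trace_sum, map_sum]
  refine Finset.sum_congr rfl fun i _ => ?_
  rw [Finset.mul_sum, Matrix.trace_sum, map_sum]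
  refine Finset.sum_congr rfl fun j _ => ?_
  rw [Matrix.vecMulVec_mul_vecMulVec, Matrix.trace_vecMulVec, dotProduct_smul, smul_eq_mul,
    dotProduct_comm (star _) (WithLp.ofLp (b' j)), ← EuclideanSpace.inner_eq_star_dotProduct,
    ← EuclideanSpace.inner_eq_star_dotProduct, ← inner_conj_symm (b' j) (b i), RCLike.mul_conj]
  norm_cast

theorem trace_coordMatrix_mul_same {𝕜 : Type*} [RCLike 𝕜] {m : ℕ}
    (b : OrthonormalBasis (Fin m) 𝕜 (EuclideanSpace 𝕜 (Fin m))) (J J' : Finset (Fin m)) :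
    RCLike.re (coordMatrix b J * coordMatrix b J').trace = (J ∩ J').card := by
  rw [trace_coordMatrix_mul]
  have h : ∀ i j, ‖inner 𝕜 (b i) (b j)‖ ^ 2 = if i = j then (1 : ℝ) else 0 := fun i j => by
    rw [orthonormal_iff_ite.mp b.orthonormal i j]; split_ifs <;> simp
  simp [h, Finset.sum_ite_mem]

theorem rank_coordProj {𝕜 : Type*} [RCLike 𝕜] {m : ℕ}
    (b : OrthonormalBasis (Fin m) 𝕜 (EuclideanSpace 𝕜 (Fin m))) (J : Finset (Fin m)) :
    (coordProj b J).1.rank = J.card := by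
  have h1 := trace_eq_rank (coordProj b J)
  have h2 := trace_coordMatrix_mul_same b J J
  have h3 : coordMatrix b J * coordMatrix b J = coordMatrix b J :=
    (coordMatrix_isStarProjection b J).isIdempotentElem
  rw [h3, Finset.inter_self] at h2
  have h4 := congrArg RCLike.re h1
  rw [RCLike.natCast_re] at h4
  exact_mod_cast (h4.symm.trans h2)

theorem inner_tracelessMap {𝕜 : Type*} [RCLike 𝕜] {m d : ℕ} (hm : 0 < m)
    {V : tracelessHermitian 𝕜 m ≃ₗ[ℝ] EuclideanSpace ℝ (Fin d)} (hV : IsHilbertSchmidtIsometry V)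
    (P Q : OrthProj 𝕜 m) :
    inner ℝ (V (tracelessMap P)) (V (tracelessMap Q)) =
      RCLike.re (P.1 * Q.1).trace - (P.1.rank : ℝ) * Q.1.rank / m := by
  have hm' : (m : ℝ) ≠ 0 := by exact_mod_cast hm.ne'
  rw [hV]
  simp only [tracelessMap, sub_mul, mul_sub, Matrix.trace_sub, Matrix.mul_smul, Matrix.smul_mul,
    Matrix.mul_one, Matrix.one_mul, Matrix.trace_smul, trace_eq_rank, Matrix.trace_one, map_sub,
    RCLike.smul_re, RCLike.natCast_re, Fintype.card_fin]
  field_simp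
  ring

theorem inner_embeddedVector {𝕜 : Type*} [RCLike 𝕜] {m d : ℕ} (hm : 0 < m)
    {V : tracelessHermitian 𝕜 m ≃ₗ[ℝ] EuclideanSpace ℝ (Fin d)} (hV : IsHilbertSchmidtIsometry V)
    (P Q : OrthProj 𝕜 m) {l : ℕ} (hP : P.1.rank = l) (hQ : Q.1.rank = l) :
    inner ℝ (embeddedVector V P) (embeddedVector V Q) =
      (RCLike.re (P.1 * Q.1).trace - (l : ℝ) ^ 2 / m) / (l * (m - l) / m) := by
  have hl : l ≤ m := by
    rw [← hP]; simpa using P.1.rank_le_card_width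
  have hpos : 0 ≤ (l : ℝ) * (m - l) / m := by
    have : (l : ℝ) ≤ m := by exact_mod_cast hl
    have : 0 ≤ (m : ℝ) - l := by linarith
    positivity
  unfold embeddedVector
  rw [real_inner_smul_left, real_inner_smul_right, inner_tracelessMap hm hV, hP, hQ, ← mul_assoc,
    ← mul_inv, Real.mul_self_sqrt hpos, inv_mul_eq_div, pow_two]

theorem inner_embeddedVector_coordProj_same {𝕜 : Type*} [RCLike 𝕜] {m d l : ℕ} (hm : 0 < m)
    {V : tracelessHermitian 𝕜 m ≃ₗ[ℝ] EuclideanSpace ℝ (Fin d)} (hV : IsHilbertSchmidtIsometry V)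
    (b : OrthonormalBasis (Fin m) 𝕜 (EuclideanSpace 𝕜 (Fin m))) {J J' : Finset (Fin m)}
    (hJ : J.card = l) (hJ' : J'.card = l) :
    inner ℝ (embeddedVector V (coordProj b J)) (embeddedVector V (coordProj b J')) =
      ((J ∩ J').card - (l : ℝ) ^ 2 / m) / (l * (m - l) / m) := by
  rw [inner_embeddedVector hm hV _ _ ((rank_coordProj b J).trans hJ)
    ((rank_coordProj b J').trans hJ')]
  simp only [coordProj, trace_coordMatrix_mul_same]

/-- Unbiasedness makes each of the l² terms of the trace equal to 1/m, which is exactly what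
removing the traces subtracts. -/
theorem inner_embeddedVector_coordProj_ne {𝕜 : Type*} [RCLike 𝕜] {m d l : ℕ} (hm : 0 < m)
    {V : tracelessHermitian 𝕜 m ≃ₗ[ℝ] EuclideanSpace ℝ (Fin d)} (hV : IsHilbertSchmidtIsometry V)
    {K : Type*} {B : K → OrthonormalBasis (Fin m) 𝕜 (EuclideanSpace 𝕜 (Fin m))} (hB : IsMUB B)
    {k k' : K} (hk : k ≠ k') {J J' : Finset (Fin m)} (hJ : J.card = l) (hJ' : J'.card = l) :
    inner ℝ (embeddedVector V (coordProj (B k) J)) (embeddedVector V (coordProj (B k') J')) = 0 := by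
  rw [inner_embeddedVector hm hV _ _ ((rank_coordProj _ J).trans hJ)
    ((rank_coordProj _ J').trans hJ')]
  simp only [coordProj, trace_coordMatrix_mul, hB k k' hk]
  simp only [Finset.sum_const, hJ, hJ', nsmul_eq_mul]
  rw [show (l : ℝ) * (l * (1 / m)) - (l : ℝ) ^ 2 / m = 0 by ring, zero_div]

/-- The complementary projection has squared Hilbert-Schmidt norm m minus the rank, and the rank is
m. -/
theorem coordMatrix_univ {𝕜 : Type*} [RCLike 𝕜] {m : ℕ}
    (b : OrthonormalBasis (Fin m) 𝕜 (EuclideanSpace 𝕜 (Fin m))) :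
    coordMatrix b Finset.univ = 1 := by
  have h0 : coordMatrix b Finset.univ * coordMatrix b Finset.univ = coordMatrix b Finset.univ :=
    (coordMatrix_isStarProjection b _).isIdempotentElem
  have hs : (coordMatrix b Finset.univ).conjTranspose = coordMatrix b Finset.univ :=
    (coordMatrix_isStarProjection b _).isSelfAdjoint
  have hr := trace_eq_rank (coordProj b Finset.univ)
  rw [rank_coordProj, Finset.card_univ, Fintype.card_fin] at hr
  have ht : ((1 - coordMatrix b Finset.univ).conjTranspose *
      (1 - coordMatrix b Finset.univ)).trace = 0 := by
    rw [Matrix.conjTranspose_sub, Matrix.conjTranspose_one, hs, sub_mul, mul_sub, mul_sub, h0]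
    simp only [mul_one, one_mul, sub_self, sub_zero, Matrix.trace_sub, Matrix.trace_one,
      Fintype.card_fin]
    rw [sub_eq_zero]
    exact hr.symm
  exact (sub_eq_zero.1 (Matrix.trace_conjTranspose_mul_self_eq_zero_iff.1 ht)).symm

/-- If every point lies in `r` blocks, then the coordinate projections onto the blocks add up to
`r` times the identity. -/
theorem sum_coordMatrix {𝕜 : Type*} [RCLike 𝕜] {m r : ℕ}
    (b : OrthonormalBasis (Fin m) 𝕜 (EuclideanSpace 𝕜 (Fin m))) {S : Finset (Finset (Fin m))}
    (hr : ∀ x, (S.filter fun J => x ∈ J).card = r) : ∑ J ∈ S, coordMatrix b J = (r : 𝕜) • 1 := by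
  rw [← coordMatrix_univ b]
  unfold coordMatrix
  rw [Finset.smul_sum, Finset.sum_comm' (t' := Finset.univ)
    (s' := fun x => S.filter fun J => x ∈ J) (by simp [and_comm])]
  refine Finset.sum_congr rfl fun x _ => ?_
  rw [Finset.sum_const, hr, Nat.cast_smul_eq_nsmul]

/-! ### The characterization -/

/-- With 2m - 2 blocks, a maximal set of MUBs gives just the number of vertices of the orthoplex:
(m/2 + 1)(2m - 2) = m(m + 1) - 2 in the real case and (m + 1)(2m - 2) = 2(m² - 1) in the complex
case. -/
theorem card_mul_eq_two_mul_embDim {𝕜 : Type*} [RCLike 𝕜] {m c : ℕ} (hm : 0 < m)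
    (hc : (c : ℚ) = maxMUB 𝕜 m) : c * (2 * m - 2) = 2 * embDim 𝕜 m := by
  obtain ⟨n, rfl⟩ : ∃ n, m = n + 1 := ⟨m - 1, by omega⟩
  unfold embDim
  unfold maxMUB at hc
  rw [show 2 * (n + 1) - 2 = 2 * n by omega]
  split_ifs at hc ⊢ with h
  · have h2 : c * 2 = n + 3 := by
      have : (c : ℚ) * 2 = n + 3 := by rw [hc]; push_cast; ring
      exact_mod_cast this
    have h3 : c * (2 * n) = (n + 3) * n := by rw [← h2]; ring
    obtain ⟨q, hq⟩ := (Nat.even_mul_succ_self (n + 1)).two_dvd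
    have h4 : (n + 1) * (n + 1 + 1) = (n + 3) * n + 2 := by ring
    have h5 : (n + 1) * (n + 1 + 1) = 2 * q := hq
    rw [h3, h5, Nat.mul_div_cancel_left _ (by norm_num)]
    omega
  · have h2 : c = n + 2 := by
      have : (c : ℚ) = n + 2 := by rw [hc]; push_cast; ring
      exact_mod_cast this
    have h3 : (n + 1) ^ 2 = (n + 2) * n + 1 := by ring
    rw [h2, h3, Nat.add_sub_cancel]
    ring

theorem maxMUB_pos (𝕜 : Type*) [RCLike 𝕜] (m : ℕ) : 0 < maxMUB 𝕜 m := by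
  unfold maxMUB; split_ifs <;> positivity

theorem eq_neg_of_inner_eq_neg_one {E : Type*} [NormedAddCommGroup E] [InnerProductSpace ℝ E]
    {u v : E} (hu : inner ℝ u u = 1) (hv : inner ℝ v v = 1) (huv : inner ℝ u v = -1) : u = -v := by
  rw [← add_eq_zero_iff_eq_neg, ← inner_self_eq_zero (𝕜 := ℝ), inner_add_left, inner_add_right,
    inner_add_right, hu, hv, real_inner_comm u v, huv]
  norm_num

/-! ### From Hadamard 3-designs to orthoplexes -/

section Forward

variable {𝕜 : Type*} [RCLike 𝕜] {m t : ℕ} {S : Finset (Finset (Fin m))} {K : Type*} [Fintype K]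
  {B : K → OrthonormalBasis (Fin m) 𝕜 (EuclideanSpace 𝕜 (Fin m))}

theorem isConstantRank_coordPacking {l : ℕ} (hl : ∀ J ∈ S, J.card = l) (hS : S.Nonempty)
    [Nonempty K] : IsConstantRank (coordPacking B S) := by
  unfold IsConstantRank mixture
  have : Nonempty (K × S) := ⟨Classical.arbitrary K, ⟨hS.choose, hS.choose_spec⟩⟩
  have h : (fun i => (coordPacking B S i).1.rank) = fun _ => l := by
    funext i
    rw [coordPacking, rank_coordProj, hl _ i.2.2]
  rw [h, Finset.image_const Finset.univ_nonempty, Finset.card_singleton]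

theorem isFusionFrame_coordPacking {r : ℕ} (hr : ∀ x, (S.filter fun J => x ∈ J).card = r)
    (hr0 : 0 < r) [Nonempty K] : IsFusionFrame (coordPacking B S) := by
  unfold IsFusionFrame
  have h : ∑ i, (coordPacking B S i).1 =
      ((Fintype.card K * r : ℕ) : 𝕜) • (1 : Matrix (Fin m) (Fin m) 𝕜) := by
    rw [Fintype.sum_prod_type]
    have h1 : ∀ k : K, ∑ J : S, (coordPacking B S (k, J)).1 = (r : 𝕜) • 1 := fun k => by
      rw [← sum_coordMatrix (B k) hr, ← Finset.sum_coe_sort S]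
      rfl
    rw [Finset.sum_congr rfl fun k _ => h1 k, Finset.sum_const, Finset.card_univ,
      ← Nat.cast_smul_eq_nsmul 𝕜, smul_smul, Nat.cast_mul]
  rw [h]
  refine Matrix.PosDef.smul Matrix.PosDef.one ?_
  have : 0 < Fintype.card K * r := Nat.mul_pos Fintype.card_pos hr0
  exact_mod_cast this

/-- Within one basis the inner product is (|J ∩ J'| - t)/t, so complementary blocks give antipodes
and other distinct blocks give orthogonal vectors. -/
theorem isMaximalOrthoplectic_coordPacking (hm : m = 4 * t) (ht : 1 ≤ t)
    (hS : IsBlockDesign 3 (2 * t) (t - 1) S) (hcard : S.card = 8 * t - 2) (hB : IsMUB B)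
    (hK : (Fintype.card K : ℚ) = maxMUB 𝕜 m) : IsMaximalOrthoplectic (coordPacking B S) := by
  have hm0 : 0 < m := by omega
  have hdim := card_mul_eq_two_mul_embDim hm0 hK
  have hKpos : 0 < Fintype.card K := by
    have := maxMUB_pos 𝕜 m
    rw [← hK] at this
    exact_mod_cast this
  obtain ⟨V, hV⟩ := exists_isHilbertSchmidtIsometry 𝕜 hm0
  refine ⟨by rw [Fintype.card_prod, Fintype.card_coe, hcard, ← hdim]; congr 1; omega, V, hV, ?_⟩
  set v : K × S → EuclideanSpace ℝ (Fin (embDim 𝕜 m)) :=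
    fun i => embeddedVector V (coordPacking B S i)
  have htR : (t : ℝ) ≠ 0 := by exact_mod_cast (by omega : t ≠ 0)
  have hsame : ∀ (k : K) (J J' : S), inner ℝ (v (k, J)) (v (k, J')) =
      (((J.1 ∩ J'.1).card : ℝ) - t) / t := fun k J J' => by
    have h := inner_embeddedVector_coordProj_same hm0 hV (B k) (hS.1 J.1 J.2) (hS.1 J'.1 J'.2)
    have hmR : (m : ℝ) = 4 * t := by rw [hm]; push_cast; rfl
    refine h.trans ?_
    rw [hmR]
    push_cast
    congr 1 <;> field_simp <;> ring
  have hdiff : ∀ (k k' : K) (J J' : S), k ≠ k' → inner ℝ (v (k, J)) (v (k', J')) = 0 :=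
    fun k k' J J' hk =>
      inner_embeddedVector_coordProj_ne hm0 hV hB hk (hS.1 J.1 J.2) (hS.1 J'.1 J'.2)
  have hself : ∀ i, inner ℝ (v i) (v i) = 1 := fun ⟨k, J⟩ => by
    rw [hsame, Finset.inter_self, hS.1 J.1 J.2]
    push_cast
    field_simp
    ring
  have hcompl : ∀ J : S, J.1ᶜ ∈ S := fun J => (card_inter_of_isBlockDesign hm ht hS hcard J.2).1
  have hneg : ∀ (k : K) (J : S), v (k, J) = -v (k, ⟨J.1ᶜ, hcompl J⟩) := fun k J => by
    refine eq_neg_of_inner_eq_neg_one (hself _) (hself _) ?_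
    rw [hsame, Finset.inter_compl, Finset.card_empty]
    field_simp
    simp
  -- The blocks through a fixed point represent each complementary pair once: m - 1 per basis, hence
  -- `embDim 𝕜 m` vectors in all.
  let x₀ : Fin m := ⟨0, hm0⟩
  let I := K × {J : S // x₀ ∈ J.1}
  have hI : Fintype.card (Fin (embDim 𝕜 m)) = Fintype.card I := by
    have h1 : Fintype.card {J : S // x₀ ∈ J.1} = 4 * t - 1 := by
      rw [← card_filter_point hm ht hS hcard x₀, Fintype.card_subtype,
        ← Finset.card_map (Function.Embedding.subtype _)]
      congr 1
      ext J
      simp [and_comm]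
    rw [Fintype.card_fin, Fintype.card_prod, h1]
    have h2 : 2 * m - 2 = 2 * (4 * t - 1) := by omega
    rw [h2] at hdim
    exact Nat.eq_of_mul_eq_mul_left two_pos (by rw [← hdim]; ring)
  let f : Fin (embDim 𝕜 m) ≃ I := Fintype.equivOfCardEq hI
  let w : I → EuclideanSpace ℝ (Fin (embDim 𝕜 m)) := fun i => v (i.1, i.2.1)
  have hw : Orthonormal ℝ w := by
    classical
    rw [orthonormal_iff_ite]
    rintro ⟨k, J, hJ⟩ ⟨k', J', hJ'⟩
    split_ifs with h
    · rw [← h]; exact hself _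
    · by_cases hk : k = k'
      · subst hk
        have hne : J'.1 ≠ J.1 := fun h' => h (by simp [Subtype.ext h'])
        have hnc : J'.1 ≠ J.1ᶜ := fun h' => by
          rw [h'] at hJ'; exact Finset.mem_compl.1 hJ' hJ
        change inner ℝ (v (k, J)) (v (k, J')) = 0
        rw [hsame, (card_inter_of_isBlockDesign hm ht hS hcard J.2).2 J'.1 J'.2 hne hnc, sub_self,
          zero_div]
      · exact hdiff _ _ _ _ hk
  have hne : Nonempty (Fin (embDim 𝕜 m)) := by
    rw [← Fin.pos_iff_nonempty]
    have : 0 < Fintype.card K * (2 * m - 2) := Nat.mul_pos hKpos (by omega)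
    omega
  have hwf : Orthonormal ℝ (w ∘ f) := hw.comp f f.injective
  let b := basisOfOrthonormalOfCardEqFinrank hwf (by simp)
  have hb : ⇑b = w ∘ f := coe_basisOfOrthonormalOfCardEqFinrank hwf _
  let e := b.toOrthonormalBasis (by rw [hb]; exact hwf)
  have he : ∀ j, e j = w (f j) := fun j => by
    rw [Module.Basis.coe_toOrthonormalBasis, hb]; rfl
  have hmem : ∀ (k : K) (J : S), x₀ ∈ J.1 → ∃ j, e j = v (k, J) := fun k J hJ =>
    ⟨f.symm (k, ⟨J, hJ⟩), by rw [he, Equiv.apply_symm_apply]⟩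
  refine ⟨e, Set.Subset.antisymm ?_ ?_⟩
  · rintro _ ⟨⟨k, J⟩, rfl⟩
    by_cases hJ : x₀ ∈ J.1
    · exact Or.inl (hmem k J hJ)
    · obtain ⟨j, hj⟩ := hmem k ⟨J.1ᶜ, hcompl J⟩ (Finset.mem_compl.2 hJ)
      exact Or.inr ⟨j, by change -e j = v (k, J); rw [hneg k J, hj]⟩
  · rintro _ (⟨j, rfl⟩ | ⟨j, rfl⟩)
    · exact ⟨((f j).1, (f j).2.1), (he j).symm⟩
    · refine ⟨((f j).1, ⟨(f j).2.1.1ᶜ, hcompl _⟩), ?_⟩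
      change v _ = -e j
      rw [he, ← neg_eq_iff_eq_neg, ← hneg]

end Forward

/-! ### From orthoplexes to Hadamard 3-designs -/

theorem FormsOrthoplex.inner_self {d : ℕ} {ι : Type*} {v : ι → EuclideanSpace ℝ (Fin d)}
    (hv : FormsOrthoplex v) (i : ι) : inner ℝ (v i) (v i) = 1 := by
  obtain ⟨e, he⟩ := hv
  have h1 : ∀ j, inner ℝ (e j) (e j) = 1 := fun j => by
    rw [real_inner_self_eq_norm_sq, e.orthonormal.1 j, one_pow]
  have hi : v i ∈ Set.range v := ⟨i, rfl⟩
  rw [he] at hi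
  rcases hi with ⟨j, hj⟩ | ⟨j, hj⟩
  · rw [← hj]; exact h1 j
  · rw [← hj]; simp

theorem FormsOrthoplex.exists_eq_neg {d : ℕ} {ι : Type*} {v : ι → EuclideanSpace ℝ (Fin d)}
    (hv : FormsOrthoplex v) (i : ι) : ∃ i', v i' = -v i := by
  obtain ⟨e, he⟩ := hv
  have hi : v i ∈ Set.range v := ⟨i, rfl⟩
  rw [he] at hi
  change -v i ∈ Set.range v
  rw [he]
  rcases hi with ⟨j, hj⟩ | ⟨j, hj⟩
  · exact Or.inr ⟨j, by rw [← hj]⟩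
  · exact Or.inl ⟨j, by rw [← hj, neg_neg]⟩

theorem FormsOrthoplex.inner_trichotomy {d : ℕ} {ι : Type*} {v : ι → EuclideanSpace ℝ (Fin d)}
    (hv : FormsOrthoplex v) (i i' : ι) :
    inner ℝ (v i) (v i') = 1 ∨ inner ℝ (v i) (v i') = -1 ∨ inner ℝ (v i) (v i') = 0 := by
  obtain ⟨e, he⟩ := hv
  have hmem : ∀ i, v i ∈ Set.range (fun j => e j) ∪ Set.range (fun j => -e j) := fun i =>
    he ▸ ⟨i, rfl⟩
  have h0 := orthonormal_iff_ite.1 e.orthonormal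
  rcases hmem i with ⟨j, hj⟩ | ⟨j, hj⟩ <;> rcases hmem i' with ⟨j', hj'⟩ | ⟨j', hj'⟩ <;>
    rw [← hj, ← hj'] <;> simp only [inner_neg_left, inner_neg_right, h0] <;> split_ifs <;> simp

theorem isHadamardThreeDesign_of_isMaximalOrthoplectic {𝕜 : Type*} [RCLike 𝕜] {m l : ℕ}
    {S : Finset (Finset (Fin m))} {K : Type*} [Fintype K]
    {B : K → OrthonormalBasis (Fin m) 𝕜 (EuclideanSpace 𝕜 (Fin m))} (hl : ∀ J ∈ S, J.card = l)
    (hB : IsMUB B) (hK : (Fintype.card K : ℚ) = maxMUB 𝕜 m) (hm : 2 < m)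
    (hP : IsMaximalOrthoplectic (coordPacking B S)) : IsHadamardThreeDesign S := by
  have hm0 : 0 < m := by omega
  have hmR : (0 : ℝ) < m := by exact_mod_cast hm0
  obtain ⟨hcard, V, hV, hv⟩ := hP
  have hKpos : 0 < Fintype.card K := by
    have := maxMUB_pos 𝕜 m
    rw [← hK] at this
    exact_mod_cast this
  rw [Fintype.card_prod, Fintype.card_coe, ← card_mul_eq_two_mul_embDim hm0 hK] at hcard
  have hScard : S.card = 2 * m - 2 := Nat.eq_of_mul_eq_mul_left hKpos hcard
  obtain ⟨k⟩ : Nonempty K := Fintype.card_pos_iff.1 hKpos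
  obtain ⟨J₀, hJ₀⟩ : S.Nonempty := by rw [← Finset.card_pos]; omega
  have hsame : ∀ J (hJ : J ∈ S) J' (hJ' : J' ∈ S),
      inner ℝ (embeddedVector V (coordPacking B S (k, ⟨J, hJ⟩)))
        (embeddedVector V (coordPacking B S (k, ⟨J', hJ'⟩))) =
      (((J ∩ J').card : ℝ) - (l : ℝ) ^ 2 / m) / (l * (m - l) / m) := fun J hJ J' hJ' =>
    inner_embeddedVector_coordProj_same hm0 hV (B k) (hl J hJ) (hl J' hJ')
  -- A zero denominator would make the quotient 0 by convention, against unit norm; this excludes l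
  -- = 0 and l = m.
  have hden : (l : ℝ) * (m - l) / m ≠ 0 := fun h => by
    have h1 := hv.inner_self (k, ⟨J₀, hJ₀⟩)
    rw [hsame, h, div_zero] at h1
    exact zero_ne_one h1
  have hl0 : 0 < l := by
    rcases Nat.eq_zero_or_pos l with h | h
    · simp [h] at hden
    · exact h
  -- the intersection numbers that belong to the inner products `-1`, `1` and `0`
  have hval : ∀ (J J' : Finset (Fin m)) (c : ℝ),
      (((J ∩ J').card : ℝ) - (l : ℝ) ^ 2 / m) / (l * (m - l) / m) = c →
      ((J ∩ J').card : ℝ) * m - l ^ 2 = c * (l * (m - l)) := fun J J' c h => by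
    rw [div_eq_iff hden] at h
    field_simp at h
    linarith
  have hneg : ∀ J ∈ S, m = 2 * l ∧ Jᶜ ∈ S := fun J hJ => by
    obtain ⟨⟨k', J', hJ'⟩, h⟩ := hv.exists_eq_neg (k, ⟨J, hJ⟩)
    have hin : inner ℝ (embeddedVector V (coordPacking B S (k, ⟨J, hJ⟩)))
        (embeddedVector V (coordPacking B S (k', ⟨J', hJ'⟩))) = -1 := by
      have h1 := hv.inner_self (k, ⟨J, hJ⟩)
      rw [h, inner_neg_right, h1]
    -- Vectors from different bases are orthogonal, so an antipode stays in its basis.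
    have hk : k = k' := by
      by_contra hk
      have h0 := inner_embeddedVector_coordProj_ne hm0 hV hB hk (hl J hJ) (hl J' hJ')
      rw [coordPacking, coordPacking, h0] at hin
      norm_num at hin
    subst hk
    rw [hsame] at hin
    have hx := hval J J' _ hin
    have hunion : ((J ∪ J').card : ℝ) + (J ∩ J').card = l + l := by
      have := Finset.card_union_add_card_inter J J'
      rw [hl J hJ, hl J' hJ'] at this
      exact_mod_cast this
    have hle : ((J ∪ J').card : ℝ) ≤ m := by
      have := Finset.card_le_univ (J ∪ J')
      rw [Fintype.card_fin] at this
      exact_mod_cast this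
    have hlR : (0 : ℝ) < l := by exact_mod_cast hl0
    have hlm : (l : ℝ) < m := by
      have h1 : (l : ℝ) ≤ m := by
        have := Finset.card_le_univ J
        rw [Fintype.card_fin, hl J hJ] at this
        exact_mod_cast this
      refine lt_of_le_of_ne h1 fun h2 => hden ?_
      rw [h2]; simp
    have hx0 : (0 : ℝ) ≤ (J ∩ J').card := Nat.cast_nonneg _
    -- With x = |J ∩ J'|, `hx` reads xm = l(2l - m), and x ≥ 0.
    have h1 : (m : ℝ) ≤ 2 * l := by
      have : 0 ≤ (l : ℝ) * (2 * l - m) := by nlinarith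
      have := nonneg_of_mul_nonneg_right this hlR
      linarith
    -- Multiplying |J ∪ J'| = 2l - x ≤ m by m and inserting xm gives (m - l)(m - 2l) ≥ 0.
    have h2 : 2 * (l : ℝ) ≤ m := by
      have : 0 ≤ ((m : ℝ) - l) * (m - 2 * l) := by nlinarith
      have := nonneg_of_mul_nonneg_right this (by linarith)
      linarith
    have h3 : (m : ℝ) = 2 * l := le_antisymm h1 h2
    have h4 : (J ∩ J').card = 0 := by
      have : ((J ∩ J').card : ℝ) * m = 0 := by rw [h3] at hx ⊢; linarith
      exact_mod_cast (mul_eq_zero.1 this).resolve_right hmR.ne'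
    have h5 : m = 2 * l := by exact_mod_cast h3
    refine ⟨h5, ?_⟩
    have : J' = Jᶜ := by
      refine Finset.eq_of_subset_of_card_le (fun x hx => ?_) ?_
      · rw [Finset.mem_compl]
        intro hxJ
        have : x ∈ J ∩ J' := Finset.mem_inter.2 ⟨hxJ, hx⟩
        rw [Finset.card_eq_zero.1 h4] at this
        simp at this
      · rw [Finset.card_compl, Fintype.card_fin, hl J hJ, hl J' hJ']; omega
    rw [← this]; exact hJ'
  have hml : m = 2 * l := (hneg J₀ hJ₀).1
  have hmlR : (m : ℝ) = 2 * l := by exact_mod_cast hml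
  have hlR : (l : ℝ) ≠ 0 := by exact_mod_cast hl0.ne'
  have hinter : ∀ J ∈ S, ∀ J' ∈ S, J' ≠ J → J' ≠ Jᶜ → 2 * (J ∩ J').card = l := by
    intro J hJ J' hJ' hne hnc
    have hx := hv.inner_trichotomy (k, ⟨J, hJ⟩) (k, ⟨J', hJ'⟩)
    rw [hsame] at hx
    rcases hx with hx | hx | hx
    · have h1 := hval J J' _ hx
      rw [hmlR] at h1
      have h2 : ((J ∩ J').card : ℝ) = l := by
        have : (l : ℝ) * (2 * ((J ∩ J').card - l)) = 0 := by linarith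
        have := (mul_eq_zero.1 this).resolve_left hlR
        linarith
      have h3 : (J ∩ J').card = l := by exact_mod_cast h2
      have h4 : J ∩ J' = J :=
        Finset.eq_of_subset_of_card_le Finset.inter_subset_left (by rw [h3, hl J hJ])
      have h5 : J ∩ J' = J' :=
        Finset.eq_of_subset_of_card_le Finset.inter_subset_right (by rw [h3, hl J' hJ'])
      exact absurd (h5.symm.trans h4) hne
    · have h1 := hval J J' _ hx
      rw [hmlR] at h1
      have h2 : ((J ∩ J').card : ℝ) = 0 := by
        have : (l : ℝ) * (2 * (J ∩ J').card) = 0 := by linarith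
        have := (mul_eq_zero.1 this).resolve_left hlR
        linarith
      have h3 : (J ∩ J').card = 0 := by exact_mod_cast h2
      refine absurd (Finset.eq_of_subset_of_card_le (fun x hx => ?_) ?_) hnc
      · rw [Finset.mem_compl]
        intro hxJ
        have : x ∈ J ∩ J' := Finset.mem_inter.2 ⟨hxJ, hx⟩
        rw [Finset.card_eq_zero.1 h3] at this
        simp at this
      · rw [Finset.card_compl, Fintype.card_fin, hl J hJ, hl J' hJ']; omega
    · have h1 := hval J J' _ hx
      rw [hmlR] at h1
      have : (l : ℝ) * (2 * (J ∩ J').card - l) = 0 := by linarith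
      have := (mul_eq_zero.1 this).resolve_left hlR
      have : (2 : ℝ) * (J ∩ J').card = l := by linarith
      exact_mod_cast this
  -- Since m > 2, the 2m - 2 blocks include a third one; it meets J₀ in l/2 points, so l is even and
  -- 4 divides m.
  obtain ⟨J₁, hJ₁, hJ₁'⟩ : ∃ J ∈ S, J ∉ ({J₀, J₀ᶜ} : Finset _) := by
    refine Finset.exists_mem_notMem_of_card_lt_card ?_
    exact lt_of_le_of_lt Finset.card_le_two (by omega)
  simp only [Finset.mem_insert, Finset.mem_singleton, not_or] at hJ₁'
  have ht := hinter J₀ hJ₀ J₁ hJ₁ hJ₁'.1 hJ₁'.2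
  set t := (J₀ ∩ J₁).card
  refine isHadamardThreeDesign_of_inter (t := t) (by omega) (by omega) (fun J hJ => (hneg J hJ).2)
    (fun J hJ => by rw [hl J hJ, ht]) (fun J hJ J' hJ' hne hnc => ?_) (by omega)
  have := hinter J hJ J' hJ' hne hnc
  omega

/-- A Hadamard 3-design and a maximal set of mutually unbiased bases give a maximal orthoplectic
fusion frame of constant rank. -/
theorem IsHadamardThreeDesign.isMaximalOrthoplectic {𝕜 : Type*} [RCLike 𝕜] {m : ℕ}
    {S : Finset (Finset (Fin m))} {K : Type*} [Fintype K]
    {B : K → OrthonormalBasis (Fin m) 𝕜 (EuclideanSpace 𝕜 (Fin m))}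
    (hS : IsHadamardThreeDesign S) (hB : IsMUB B) (hK : (Fintype.card K : ℚ) = maxMUB 𝕜 m) :
    IsMaximalOrthoplectic (coordPacking B S) ∧ IsConstantRank (coordPacking B S) ∧
      IsFusionFrame (coordPacking B S) := by
  obtain ⟨t, ht, hm, hD, hcard⟩ := hS
  have hKpos : 0 < Fintype.card K := by
    have := maxMUB_pos 𝕜 m
    rw [← hK] at this
    exact_mod_cast this
  have : Nonempty K := Fintype.card_pos_iff.1 hKpos
  exact ⟨isMaximalOrthoplectic_coordPacking hm ht hD hcard hB hK,
    isConstantRank_coordPacking hD.1 (by rw [← Finset.card_pos]; omega),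
    isFusionFrame_coordPacking (card_filter_point hm ht hD hcard) (by omega)⟩

/-! ### Signs of linear functionals over the field with two elements -/

/-- The nontrivial additive character of `ZMod 2` with values `±1`. -/
def zmodSign (R : Type*) [CommRing R] (a : ZMod 2) : R := if a = 0 then 1 else -1

theorem zmod_two_eq_zero_or_one (a : ZMod 2) : a = 0 ∨ a = 1 := by
  revert a
  decide

section zmodSign

variable {R : Type*} [CommRing R]

theorem zmodSign_zero : zmodSign R 0 = 1 := by simp [zmodSign]

theorem zmodSign_one : zmodSign R 1 = -1 := by simp [zmodSign]

theorem zmodSign_add (a b : ZMod 2) : zmodSign R (a + b) = zmodSign R a * zmodSign R b := by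
  rcases zmod_two_eq_zero_or_one a with rfl | rfl <;>
    rcases zmod_two_eq_zero_or_one b with rfl | rfl <;>
    simp [zmodSign, CharTwo.add_self_eq_zero]

theorem zmodSign_mul_self (a : ZMod 2) : zmodSign R a * zmodSign R a = 1 := by
  rw [← zmodSign_add, CharTwo.add_self_eq_zero, zmodSign_zero]

theorem zmodSign_sum {ι : Type*} (s : Finset ι) (f : ι → ZMod 2) :
    zmodSign R (∑ i ∈ s, f i) = ∏ i ∈ s, zmodSign R (f i) := by
  classical
  induction s using Finset.induction_on with
  | empty => simp [zmodSign_zero]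
  | insert i s hi ih => rw [Finset.sum_insert hi, Finset.prod_insert hi, zmodSign_add, ih]

/-- Translation by a point where f is 1 permutes V and flips every sign. -/
theorem sum_zmodSign_linear [IsDomain R] [CharZero R] {V : Type*} [AddCommGroup V]
    [Module (ZMod 2) V] [Fintype V] {f : V →ₗ[ZMod 2] ZMod 2} (hf : f ≠ 0) :
    ∑ x, zmodSign R (f x) = 0 := by
  obtain ⟨y, hy⟩ : ∃ y, f y ≠ 0 := by
    by_contra! h
    exact hf (LinearMap.ext h)
  have hy1 : f y = 1 := (zmod_two_eq_zero_or_one _).resolve_left hy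
  have h : ∑ x, zmodSign R (f x) = ∑ x, -zmodSign R (f x) := by
    rw [← Equiv.sum_comp (Equiv.addRight y)]
    refine Finset.sum_congr rfl fun x _ => ?_
    rw [Equiv.coe_addRight, map_add, zmodSign_add, hy1, zmodSign_one]
    ring
  rw [Finset.sum_neg_distrib] at h
  exact self_eq_neg.1 h

end zmodSign

theorem norm_zmodSign {𝕜 : Type*} [RCLike 𝕜] (a : ZMod 2) : ‖zmodSign 𝕜 a‖ = 1 := by
  unfold zmodSign; split_ifs <;> simp

theorem conj_zmodSign {𝕜 : Type*} [RCLike 𝕜] (a : ZMod 2) :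
    starRingEnd 𝕜 (zmodSign 𝕜 a) = zmodSign 𝕜 a := by
  unfold zmodSign; split_ifs <;> simp

/-! ### Hadamard 3-designs from affine hyperplanes -/

theorem card_dual_zmod_two {V : Type*} [AddCommGroup V] [Module (ZMod 2) V] [Finite V] :
    Nat.card (Module.Dual (ZMod 2) V) = Nat.card V :=
  (Nat.card_congr (Module.finBasis (ZMod 2) V).toDualEquiv.toEquiv).symm

/-- The blocks are the 2(m - 1) affine hyperplanes f = c of an n-dimensional space. Their sign
vectors are, up to sign, the nontrivial characters, whose orthogonality gives the sizes and
intersections. -/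
theorem exists_isHadamardThreeDesign {n m : ℕ} (hn : 2 ≤ n) (hm : m = 2 ^ n) :
    ∃ S : Finset (Finset (Fin m)), IsHadamardThreeDesign S := by
  classical
  let V := Fin n → ZMod 2
  have hVcard : Fintype.card V = m := by simp [V, hm]
  let e : Fin m ≃ V := Fintype.equivOfCardEq (by rw [hVcard, Fintype.card_fin])
  obtain ⟨t, ht, hmt⟩ : ∃ t, 1 ≤ t ∧ m = 4 * t :=
    ⟨2 ^ (n - 2), Nat.one_le_two_pow, by
      rw [hm, show (4 : ℕ) = 2 ^ 2 by norm_num, ← pow_add]; congr 1; omega⟩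
  let D := Module.Dual (ZMod 2) V
  have : Finite D := Module.finite_of_finite (ZMod 2)
  let _ : Fintype D := Fintype.ofFinite D
  have hDcard : Fintype.card D = m := by
    rw [← hVcard, ← Nat.card_eq_fintype_card, ← Nat.card_eq_fintype_card, card_dual_zmod_two]
  let H : {f : D // f ≠ 0} × ZMod 2 → Finset (Fin m) := fun p =>
    Finset.univ.filter fun i => p.1.1 (e i) = p.2
  have hsign : ∀ p i, signOf (H p) i = zmodSign ℤ (p.1.1 (e i)) * zmodSign ℤ p.2 := fun p i => by
    rw [← zmodSign_add]
    unfold signOf zmodSign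
    simp only [H, Finset.mem_filter, Finset.mem_univ, true_and, CharTwo.add_eq_zero]
  have hcard : ∀ p, (H p).card = 2 * t := fun p => by
    have h := sum_signOf (H p)
    simp only [hsign] at h
    rw [← Finset.sum_mul, e.sum_comp (fun x => zmodSign ℤ (p.1.1 x)), sum_zmodSign_linear p.1.2,
      Fintype.card_fin] at h
    omega
  have hinter : ∀ p q, p.1 ≠ q.1 → (H p ∩ H q).card = t := fun p q hpq => by
    have h := sum_signOf_mul_signOf (H p) (H q)
    have hne : p.1.1 + q.1.1 ≠ 0 := fun h0 => hpq (by
      apply Subtype.ext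
      refine LinearMap.ext fun x => ?_
      have := LinearMap.congr_fun h0 x
      exact CharTwo.add_eq_zero.1 this)
    have h2 : ∀ i, signOf (H p) i * signOf (H q) i =
        zmodSign ℤ ((p.1.1 + q.1.1) (e i)) * (zmodSign ℤ p.2 * zmodSign ℤ q.2) := fun i => by
      rw [hsign, hsign, LinearMap.add_apply, zmodSign_add]; ring
    simp only [h2] at h
    rw [← Finset.sum_mul, e.sum_comp (fun x => zmodSign ℤ ((p.1.1 + q.1.1) x)),
      sum_zmodSign_linear hne, hcard, hcard, Fintype.card_fin] at h
    omega
  have hcompl : ∀ p : {f : D // f ≠ 0} × ZMod 2, H (p.1, p.2 + 1) = (H p)ᶜ := fun p => by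
    ext i
    simp only [H, Finset.mem_filter, Finset.mem_univ, true_and, Finset.mem_compl]
    generalize p.1.1 (e i) = a
    generalize p.2 = c
    revert a c
    decide
  have hcases : ∀ p q : {f : D // f ≠ 0} × ZMod 2, p.1 = q.1 → q = p ∨ q = (p.1, p.2 + 1) := by
    rintro ⟨f, c⟩ ⟨g, d⟩ h
    obtain rfl : f = g := h
    have : d = c ∨ d = c + 1 := by revert c d; decide
    rcases this with rfl | rfl <;> simp
  have hne : ∀ J : Finset (Fin m), J.card = 2 * t → Jᶜ ≠ J := fun J hJ h => by
    obtain ⟨x, hx⟩ : J.Nonempty := by rw [← Finset.card_pos]; omega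
    have hx' : x ∈ Jᶜ := by rw [h]; exact hx
    exact Finset.mem_compl.1 hx' hx
  have hinj : Function.Injective H := fun p q hpq => by
    by_cases h : p.1 = q.1
    · rcases hcases p q h with h | h
      · exact h.symm
      · rw [h, hcompl] at hpq
        exact absurd hpq.symm (hne _ (hcard p))
    · have h1 := hinter p q h
      rw [← hpq, Finset.inter_self, hcard] at h1
      omega
  refine ⟨Finset.univ.image H, isHadamardThreeDesign_of_inter hmt ht ?_ ?_ ?_ ?_⟩
  · intro J hJ
    obtain ⟨p, -, rfl⟩ := Finset.mem_image.1 hJ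
    rw [← hcompl]
    exact Finset.mem_image_of_mem _ (Finset.mem_univ _)
  · intro J hJ
    obtain ⟨p, -, rfl⟩ := Finset.mem_image.1 hJ
    exact hcard p
  · intro J hJ J' hJ' h1 h2
    obtain ⟨p, -, rfl⟩ := Finset.mem_image.1 hJ
    obtain ⟨q, -, rfl⟩ := Finset.mem_image.1 hJ'
    refine hinter p q fun h => ?_
    rcases hcases p q h with rfl | h
    · exact h1 rfl
    · exact h2 (by rw [h, hcompl])
  · rw [Finset.card_image_of_injective _ hinj, Finset.card_univ, Fintype.card_prod, ZMod.card,
      Fintype.card_subtype_compl, Fintype.card_subtype_eq, hDcard]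
    omega

/-! ### Quadratic phase functions -/

/-- A symmetric bilinear form over `ZMod 2` is the polarization of a unimodular function, as soon
as the field contains the necessary square roots of the diagonal signs. -/
theorem exists_quadratic_phase {𝕜 : Type*} [RCLike 𝕜] {V : Type*} [AddCommGroup V]
    [Module (ZMod 2) V] [Finite V] (β : V →ₗ[ZMod 2] V →ₗ[ZMod 2] ZMod 2)
    (hβ : ∀ x y, β x y = β y x) (hsqrt : ∀ x, ∃ c : 𝕜, c * c = zmodSign 𝕜 (β x x)) :
    ∃ φ : V → 𝕜, (∀ x, ‖φ x‖ = 1) ∧ ∀ x y, φ (x + y) = φ x * φ y * zmodSign 𝕜 (β x y) := by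
  let b := Module.finBasis (ZMod 2) V
  choose c hc using fun i => hsqrt (b i)
  have hcn : ∀ i, ‖c i‖ = 1 := fun i => by
    have h := congrArg norm (hc i)
    rw [norm_mul, norm_zmodSign] at h
    nlinarith [norm_nonneg (c i)]
  let X : V → Fin (Module.finrank (ZMod 2) V) → ZMod 2 := fun x => b.equivFun x
  have hX : ∀ x y i, X (x + y) i = X x i + X y i := fun x y i => by simp [X]
  -- A one-variable phase polarizing to the diagonal entry: 1 + 1 = 0 demands that the square of c i
  -- be the diagonal sign.
  let g : Fin (Module.finrank (ZMod 2) V) → ZMod 2 → 𝕜 := fun i a => if a = 0 then 1 else c i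
  have hg : ∀ i a a', g i (a + a') = g i a * g i a' * zmodSign 𝕜 (β (b i) (b i) * a * a') := by
    intro i a a'
    have h1 : c i * c i * zmodSign 𝕜 (β (b i) (b i)) = 1 := by rw [hc, zmodSign_mul_self]
    rcases zmod_two_eq_zero_or_one a with rfl | rfl <;>
      rcases zmod_two_eq_zero_or_one a' with rfl | rfl <;>
      simp [g, zmodSign_zero, CharTwo.add_self_eq_zero, h1]
  -- The strict lower triangle suffices off the diagonal: by symmetry, its polarization supplies
  -- both triangles.
  let Q : V → ZMod 2 := fun x => ∑ i, ∑ j, if j < i then β (b i) (b j) * X x i * X x j else 0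
  have hβX : ∀ x y, β x y = ∑ i, ∑ j, β (b i) (b j) * X x i * X y j := fun x y => by
    conv_lhs => rw [← b.sum_equivFun x, ← b.sum_equivFun y]
    simp only [map_sum, LinearMap.sum_apply, map_smul, LinearMap.smul_apply, smul_eq_mul,
      Finset.mul_sum]
    rw [Finset.sum_comm]
    refine Finset.sum_congr rfl fun i _ => Finset.sum_congr rfl fun j _ => ?_
    simp only [X]
    ring
  have hQ : ∀ x y, Q (x + y) + (∑ i, β (b i) (b i) * X x i * X y i) = Q x + Q y + β x y := by
    intro x y
    have hswap : (∑ i, ∑ j, if j < i then β (b i) (b j) * X y i * X x j else 0) =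
        ∑ i, ∑ j, if i < j then β (b i) (b j) * X x i * X y j else 0 := by
      rw [Finset.sum_comm]
      refine Finset.sum_congr rfl fun i _ => Finset.sum_congr rfl fun j _ => ?_
      rw [hβ (b j) (b i)]
      split_ifs
      · ring
      · rfl
    have hdiag : (∑ i, β (b i) (b i) * X x i * X y i) =
        ∑ i, ∑ j, if i = j then β (b i) (b j) * X x i * X y j else 0 := by
      simp
    have hexp : Q (x + y) = Q x + Q y +
        (∑ i, ∑ j, if j < i then β (b i) (b j) * X x i * X y j else 0) +
        ∑ i, ∑ j, if j < i then β (b i) (b j) * X y i * X x j else 0 := by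
      simp only [Q, ← Finset.sum_add_distrib]
      refine Finset.sum_congr rfl fun i _ => Finset.sum_congr rfl fun j _ => ?_
      rw [hX, hX]
      split_ifs
      · ring
      · ring
    rw [hexp, hswap, hdiag, hβX, add_assoc, add_assoc]
    congr 1
    simp only [← Finset.sum_add_distrib]
    refine Finset.sum_congr rfl fun i _ => Finset.sum_congr rfl fun j _ => ?_
    rcases lt_trichotomy i j with h | h | h
    · simp [h, h.not_gt, h.ne]
    · simp [h]
    · simp [h, h.not_gt, h.ne']
  refine ⟨fun x => (∏ i, g i (X x i)) * zmodSign 𝕜 (Q x), fun x => ?_, fun x y => ?_⟩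
  · rw [norm_mul, norm_zmodSign, mul_one, norm_prod]
    refine Finset.prod_eq_one fun i _ => ?_
    simp only [g]
    split_ifs
    · exact norm_one
    · exact hcn i
  · have h1 : zmodSign 𝕜 (Q (x + y)) * zmodSign 𝕜 (∑ i, β (b i) (b i) * X x i * X y i) =
        zmodSign 𝕜 (Q x) * zmodSign 𝕜 (Q y) * zmodSign 𝕜 (β x y) := by
      rw [← zmodSign_add, hQ, zmodSign_add, zmodSign_add]
    have h2 : (∏ i, g i (X (x + y) i)) = (∏ i, g i (X x i)) * (∏ i, g i (X y i)) *
        zmodSign 𝕜 (∑ i, β (b i) (b i) * X x i * X y i) := by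
      rw [zmodSign_sum, ← Finset.prod_mul_distrib, ← Finset.prod_mul_distrib]
      exact Finset.prod_congr rfl fun i _ => by rw [hX, hg]
    simp only [h2]
    linear_combination ((∏ i, g i (X x i)) * ∏ i, g i (X y i)) * h1

/-- The Gauss sum of a nondegenerate quadratic phase function. -/
theorem norm_sq_sum_quadratic_phase {𝕜 : Type*} [RCLike 𝕜] {V : Type*} [AddCommGroup V]
    [Module (ZMod 2) V] [Fintype V] (γ : V →ₗ[ZMod 2] V →ₗ[ZMod 2] ZMod 2)
    (hγ : ∀ x, γ x = 0 → x = 0) {D : V → 𝕜} (hD : ∀ x, ‖D x‖ = 1)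
    (hadd : ∀ x y, D (x + y) = D x * D y * zmodSign 𝕜 (γ x y)) :
    ‖∑ x, D x‖ ^ 2 = Fintype.card V := by
  have h0 : D 0 = 1 := by
    have h := hadd 0 0
    rw [add_zero, map_zero, zmodSign_zero, mul_one] at h
    have hne : D 0 ≠ 0 := fun h' => by simpa [h'] using hD 0
    exact (mul_eq_left₀ hne).1 h.symm
  have hconj : ∀ y, D y * starRingEnd 𝕜 (D y) = 1 := fun y => by
    rw [RCLike.mul_conj, hD]; simp
  have h : (∑ x, D x) * starRingEnd 𝕜 (∑ x, D x) = (Fintype.card V : 𝕜) := by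
    calc (∑ x, D x) * starRingEnd 𝕜 (∑ x, D x)
        = ∑ y, ∑ x, D x * starRingEnd 𝕜 (D y) := by
          rw [map_sum, Finset.sum_mul_sum, Finset.sum_comm]
      _ = ∑ y, ∑ u, D u * zmodSign 𝕜 (γ u y) := by
          refine Finset.sum_congr rfl fun y _ => ?_
          -- Substituting x = u + y cancels D y against its conjugate; the sum over y is then a
          -- character sum, zero unless u = 0.
          rw [← Equiv.sum_comp (Equiv.addRight y)]
          refine Finset.sum_congr rfl fun u _ => ?_
          rw [Equiv.coe_addRight, hadd]
          linear_combination (D u * zmodSign 𝕜 (γ u y)) * hconj y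
      _ = ∑ u, D u * ∑ y, zmodSign 𝕜 (γ u y) := by
          rw [Finset.sum_comm]
          simp only [Finset.mul_sum]
      _ = (Fintype.card V : 𝕜) := by
          rw [Finset.sum_eq_single 0]
          · simp [h0, zmodSign_zero]
          · intro u _ hu
            rw [sum_zmodSign_linear fun h' => hu (hγ u h'), mul_zero]
          · simp
  rw [RCLike.mul_conj] at h
  exact_mod_cast h

/-! ### Mutually unbiased bases from sets of bilinear forms -/

theorem exists_orthonormalBasis_eq {𝕜 : Type*} [RCLike 𝕜] {m : ℕ}
    {v : Fin m → EuclideanSpace 𝕜 (Fin m)} (hv : Orthonormal 𝕜 v) :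
    ∃ b : OrthonormalBasis (Fin m) 𝕜 (EuclideanSpace 𝕜 (Fin m)), ⇑b = v := by
  refine ⟨OrthonormalBasis.mk hv ?_, OrthonormalBasis.coe_mk _ _⟩
  exact (hv.linearIndependent.span_eq_top_of_card_eq_finrank' (by simp)).ge

/-- Besides the standard basis (`none`), each form gives the basis of all characters of V multiplied
by its phase and divided by √m. Inner products across two forms are, up to the factor 1/m, Gauss
sums for the nondegenerate difference of the forms. -/
theorem exists_isMUB_of_forms {𝕜 : Type*} [RCLike 𝕜] {V : Type*} [AddCommGroup V]
    [Module (ZMod 2) V] [Fintype V] {Z : Type*} {m : ℕ} (hm : Fintype.card V = m)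
    (β : Z → V →ₗ[ZMod 2] V →ₗ[ZMod 2] ZMod 2) (hsymm : ∀ z x y, β z x y = β z y x)
    (hnondeg : ∀ z w, z ≠ w → ∀ x, β z x = β w x → x = 0)
    (hsqrt : ∀ z x, ∃ c : 𝕜, c * c = zmodSign 𝕜 (β z x x)) :
    ∃ B : Option Z → OrthonormalBasis (Fin m) 𝕜 (EuclideanSpace 𝕜 (Fin m)), IsMUB B := by
  have hm0 : 0 < m := hm ▸ Fintype.card_pos
  have hmR : (0 : ℝ) < m := by exact_mod_cast hm0
  have hmK : (m : 𝕜) ≠ 0 := by exact_mod_cast hm0.ne'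
  choose φ hφ hadd using fun z => exists_quadratic_phase (β z) (hsymm z) (hsqrt z)
  let e : Fin m ≃ V := Fintype.equivOfCardEq (by rw [hm, Fintype.card_fin])
  let δ := (Module.finBasis (ZMod 2) V).toDualEquiv
  let s : 𝕜 := ((Real.sqrt m)⁻¹ : ℝ)
  have hs : s * s = (m : 𝕜)⁻¹ := by
    simp only [s]
    rw [← RCLike.ofReal_mul, ← mul_inv, Real.mul_self_sqrt hmR.le]
    simp
  have hsn : ‖s‖ ^ 2 = 1 / m := by
    simp only [s]
    rw [RCLike.norm_ofReal, sq_abs, inv_pow, Real.sq_sqrt hmR.le, one_div]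
  let F : Z → Fin m → EuclideanSpace 𝕜 (Fin m) := fun z j =>
    WithLp.toLp 2 fun i => s * (φ z (e i) * zmodSign 𝕜 (δ (e j) (e i)))
  have hinner : ∀ z w j j', inner 𝕜 (F z j) (F w j') = (m : 𝕜)⁻¹ *
      ∑ x, φ w x * starRingEnd 𝕜 (φ z x) * zmodSign 𝕜 ((δ (e j) + δ (e j')) x) := by
    intro z w j j'
    rw [PiLp.inner_apply, Finset.mul_sum, ← e.sum_comp]
    refine Finset.sum_congr rfl fun i _ => ?_
    have hsc : starRingEnd 𝕜 s = s := RCLike.conj_ofReal _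
    simp only [F, RCLike.inner_apply, map_mul, conj_zmodSign, hsc, LinearMap.add_apply,
      zmodSign_add, ← hs]
    ring
  have hF : ∀ z, Orthonormal 𝕜 (F z) := fun z => by
    rw [orthonormal_iff_ite]
    intro j j'
    have h1 : ∀ x, φ z x * starRingEnd 𝕜 (φ z x) = 1 := fun x => by
      rw [RCLike.mul_conj, hφ]; simp
    simp only [hinner, h1, one_mul]
    split_ifs with h
    · subst h
      have h2 : ∀ x, (δ (e j) + δ (e j)) x = 0 := fun x => CharTwo.add_self_eq_zero _
      simp only [h2, zmodSign_zero, Finset.sum_const, Finset.card_univ, hm, nsmul_eq_mul, mul_one]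
      exact inv_mul_cancel₀ hmK
    · rw [sum_zmodSign_linear, mul_zero]
      intro h0
      refine h (e.injective (δ.injective (LinearMap.ext fun x => ?_)))
      exact CharTwo.add_eq_zero.1 (LinearMap.congr_fun h0 x)
  have hFF : ∀ z w, z ≠ w → ∀ j j', ‖inner 𝕜 (F z j) (F w j')‖ ^ 2 = 1 / (m : ℝ) := by
    intro z w hzw j j'
    have hG := norm_sq_sum_quadratic_phase (β w + β z) (fun x hx => hnondeg z w hzw x
      (LinearMap.ext fun y => (CharTwo.add_eq_zero.1 (LinearMap.congr_fun hx y)).symm))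
      (D := fun x => φ w x * starRingEnd 𝕜 (φ z x) * zmodSign 𝕜 ((δ (e j) + δ (e j')) x))
      (fun x => by simp only [norm_mul, RCLike.norm_conj, hφ, norm_zmodSign, one_mul])
      (fun x y => by
        simp only [hadd, map_mul, conj_zmodSign, map_add, LinearMap.add_apply, zmodSign_add]
        ring)
    rw [hinner, norm_mul, mul_pow, hG, hm, norm_inv, RCLike.norm_natCast]
    field_simp
  have hstd : ∀ z i j, ‖inner 𝕜 (EuclideanSpace.basisFun (Fin m) 𝕜 i) (F z j)‖ ^ 2 =
      1 / (m : ℝ) := fun z i j => by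
    rw [EuclideanSpace.basisFun_inner]
    simp only [F]
    rw [norm_mul, norm_mul, hφ, norm_zmodSign, mul_one, mul_one, hsn]
  choose C hC using fun z => exists_orthonormalBasis_eq (hF z)
  refine ⟨fun o => o.elim (EuclideanSpace.basisFun (Fin m) 𝕜) C, ?_⟩
  rintro (_ | z) (_ | w) h j j'
  · exact absurd rfl h
  · simp only [Option.elim, hC, hstd]
  · simp only [Option.elim, hC]
    rw [norm_inner_symm, hstd]
  · simp only [Option.elim, hC]
    exact hFF z w (fun h' => h (congrArg some h')) j j'

theorem IsMUB.comp {𝕜 : Type*} [RCLike 𝕜] {m : ℕ} {K K' : Type*}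
    {B : K → OrthonormalBasis (Fin m) 𝕜 (EuclideanSpace 𝕜 (Fin m))} (hB : IsMUB B) {f : K' → K}
    (hf : Function.Injective f) : IsMUB (B ∘ f) := fun k k' hk j j' =>
  hB (f k) (f k') (hf.ne hk) j j'

/-! ### Maximal sets of mutually unbiased bases -/

theorem eq_zero_of_trace_mul_eq_zero {F : Type*} [Field F] [Algebra (ZMod 2) F] [Finite F] {a : F}
    (h : ∀ y, Algebra.trace (ZMod 2) F (a * y) = 0) : a = 0 :=
  (traceForm_nondegenerate (ZMod 2) F).1 a h

/-- The forms Tr(zxy), for z in the field with m elements, differ by Tr((z - w)xy), nondegenerate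
for z ≠ w. They need not be alternating; the imaginary unit provides the square roots of -1. -/
theorem exists_complex_isMUB {n m : ℕ} (hn : n ≠ 0) (hm : m = 2 ^ n) :
    ∃ B : Fin (m + 1) → OrthonormalBasis (Fin m) ℂ (EuclideanSpace ℂ (Fin m)), IsMUB B := by
  let F := GaloisField 2 n
  let _ : Fintype F := Fintype.ofFinite F
  have hF : Fintype.card F = m := by
    rw [hm, ← GaloisField.card 2 n hn, Nat.card_eq_fintype_card]
  let β : F → F →ₗ[ZMod 2] F →ₗ[ZMod 2] ZMod 2 := fun z =>
    LinearMap.mk₂ (ZMod 2) (fun x y => Algebra.trace (ZMod 2) F (z * x * y))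
      (fun x x' y => by rw [mul_add, add_mul, map_add])
      (fun c x y => by rw [mul_smul_comm, smul_mul_assoc, map_smul])
      (fun x y y' => by rw [mul_add, map_add])
      (fun c x y => by rw [mul_smul_comm, map_smul])
  obtain ⟨B, hB⟩ := exists_isMUB_of_forms (𝕜 := ℂ) hF β
    (fun z x y => by simp only [β, LinearMap.mk₂_apply]; congr 1; ring)
    (fun z w hzw x hx => by
      have h : (z - w) * x = 0 := eq_zero_of_trace_mul_eq_zero fun y => by
        have := LinearMap.congr_fun hx y
        simp only [β, LinearMap.mk₂_apply] at this
        rw [sub_mul, sub_mul, map_sub, this, sub_self]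
      exact (mul_eq_zero.1 h).resolve_left (sub_ne_zero.2 hzw))
    (fun z x => by
      unfold zmodSign
      split_ifs
      · exact ⟨1, one_mul 1⟩
      · exact ⟨Complex.I, Complex.I_mul_I⟩)
  let f : Fin (m + 1) ≃ Option F :=
    Fintype.equivOfCardEq (by rw [Fintype.card_option, hF, Fintype.card_fin])
  exact ⟨B ∘ f, hB.comp f.injective⟩

theorem trace_sq {F : Type*} [Field F] [Algebra (ZMod 2) F] [Finite F] (u : F) :
    Algebra.trace (ZMod 2) F (u ^ 2) = Algebra.trace (ZMod 2) F u := by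
  have : CharP F 2 := charP_of_injective_algebraMap (algebraMap (ZMod 2) F).injective 2
  have : ExpChar F 2 := ExpChar.prime Nat.prime_two
  have h := Algebra.trace_eq_of_algEquiv (FiniteField.frobeniusAlgEquiv (ZMod 2) F 2) u
  rwa [FiniteField.frobeniusAlgEquiv_apply, ZMod.card] at h

/-- The Kerdock set of alternating bilinear forms on `F × ZMod 2`. -/
noncomputable def kerdockForm {F : Type*} [Field F] [Algebra (ZMod 2) F] (z : F) :
    (F × ZMod 2) →ₗ[ZMod 2] (F × ZMod 2) →ₗ[ZMod 2] ZMod 2 :=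
  LinearMap.mk₂ (ZMod 2) (fun x y => Algebra.trace (ZMod 2) F (z ^ 2 * x.1 * y.1) +
      Algebra.trace (ZMod 2) F (z * x.1) * Algebra.trace (ZMod 2) F (z * y.1) +
      x.2 * Algebra.trace (ZMod 2) F (z * y.1) + y.2 * Algebra.trace (ZMod 2) F (z * x.1))
    (fun x x' y => by
      simp only [Prod.fst_add, Prod.snd_add, mul_add, add_mul, map_add]; ring)
    (fun c x y => by
      simp only [Prod.smul_fst, Prod.smul_snd, mul_smul_comm, smul_mul_assoc, map_smul,
        smul_eq_mul]
      ring)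
    (fun x y y' => by
      simp only [Prod.fst_add, Prod.snd_add, mul_add, add_mul, map_add]; ring)
    (fun c x y => by
      simp only [Prod.smul_fst, Prod.smul_snd, mul_smul_comm, map_smul, smul_eq_mul]
      ring)

theorem kerdockForm_apply {F : Type*} [Field F] [Algebra (ZMod 2) F] (z : F) (x y : F × ZMod 2) :
    kerdockForm z x y = Algebra.trace (ZMod 2) F (z ^ 2 * x.1 * y.1) +
      Algebra.trace (ZMod 2) F (z * x.1) * Algebra.trace (ZMod 2) F (z * y.1) +
      x.2 * Algebra.trace (ZMod 2) F (z * y.1) + y.2 * Algebra.trace (ZMod 2) F (z * x.1) := rfl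

/-- Tr((zx)²) = Tr(zx) = Tr(zx)² cancels in characteristic two. With a zero diagonal, real phases
exist. -/
theorem kerdockForm_self {F : Type*} [Field F] [Algebra (ZMod 2) F] [Finite F] (z : F)
    (x : F × ZMod 2) : kerdockForm z x x = 0 := by
  rw [kerdockForm_apply, show z ^ 2 * x.1 * x.1 = (z * x.1) ^ 2 by ring, trace_sq]
  generalize Algebra.trace (ZMod 2) F (z * x.1) = a
  generalize x.2 = b
  revert a b
  decide

/-- In odd degree, differences of different members of the Kerdock set are nondegenerate. -/
theorem eq_zero_of_kerdockForm_eq {F : Type*} [Field F] [Algebra (ZMod 2) F] [Finite F]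
    (hodd : Algebra.trace (ZMod 2) F 1 = 1) {z w : F} (hzw : z ≠ w) {x : F × ZMod 2}
    (hx : kerdockForm z x = kerdockForm w x) : x = 0 := by
  obtain ⟨x, a⟩ := x
  have : CharP F 2 := charP_of_injective_algebraMap (algebraMap (ZMod 2) F).injective 2
  have hzw' : z + w ≠ 0 := fun h => hzw (CharTwo.add_eq_zero.1 h)
  -- Testing against (0, 1) gives this equality; testing against all (y, 0) gives `h2`.
  have h1 : Algebra.trace (ZMod 2) F (z * x) = Algebra.trace (ZMod 2) F (w * x) := by
    have := LinearMap.congr_fun hx (0, 1)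
    simpa [kerdockForm_apply] using this
  set ε := Algebra.trace (ZMod 2) F (z * x) with hε
  have h2 : (z + w) ^ 2 * x + algebraMap (ZMod 2) F (ε + a) * (z + w) = 0 :=
    eq_zero_of_trace_mul_eq_zero fun y => by
      have h := LinearMap.congr_fun hx (y, 0)
      simp only [kerdockForm_apply, ← h1, ← hε, zero_mul, add_zero] at h
      rw [add_mul, map_add, CharTwo.add_sq, mul_assoc (algebraMap _ _ _), ← Algebra.smul_def,
        map_smul, smul_eq_mul, add_mul (z ^ 2), add_mul (z ^ 2 * x), map_add, add_mul z, map_add]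
      linear_combination h + (Algebra.trace (ZMod 2) F (w ^ 2 * x * y)
        + (ε + a) * Algebra.trace (ZMod 2) F (w * y)) * (CharTwo.two_eq_zero : (2 : ZMod 2) = 0)
  have h3 : (z + w) * x = algebraMap (ZMod 2) F (ε + a) := by
    have : (z + w) * ((z + w) * x + algebraMap (ZMod 2) F (ε + a)) = 0 := by
      rw [← h2]; ring
    exact CharTwo.add_eq_zero.1 ((mul_eq_zero.1 this).resolve_left hzw')
  have h4 : ε + a = 0 := by
    have h5 : Algebra.trace (ZMod 2) F ((z + w) * x) = 0 := by
      rw [add_mul, map_add, ← h1, CharTwo.add_self_eq_zero]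
    rw [h3, ← mul_one (algebraMap _ _ _), ← Algebra.smul_def, map_smul, hodd, smul_eq_mul,
      mul_one] at h5
    exact h5
  rw [h4, map_zero] at h3
  have hx0 : x = 0 := (mul_eq_zero.1 h3).resolve_left hzw'
  have hε0 : ε = 0 := by rw [hε, hx0, mul_zero, map_zero]
  rw [hε0, zero_add] at h4
  rw [hx0, h4]
  rfl

/-- The field F of degree 2a - 1 has m/2 elements, one Kerdock form each on F × `ZMod 2`, which has
m elements; the odd degree yields Tr 1 = 1. -/
theorem exists_real_isMUB {a m : ℕ} (ha : 1 ≤ a) (hm : m = 4 ^ a) :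
    ∃ B : Fin (m / 2 + 1) → OrthonormalBasis (Fin m) ℝ (EuclideanSpace ℝ (Fin m)), IsMUB B := by
  have hn : 2 * a - 1 ≠ 0 := by omega
  let F := GaloisField 2 (2 * a - 1)
  let _ : Fintype F := Fintype.ofFinite F
  have hF : Fintype.card F = 2 ^ (2 * a - 1) := by
    rw [← GaloisField.card 2 _ hn, Nat.card_eq_fintype_card]
  have hm2 : m = 2 ^ (2 * a - 1) * 2 := by
    rw [hm, ← pow_succ, show 2 * a - 1 + 1 = 2 * a by omega, pow_mul]
    norm_num
  have hodd : Algebra.trace (ZMod 2) F 1 = 1 := by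
    have h := Algebra.trace_algebraMap (S := F) (1 : ZMod 2)
    rw [map_one, GaloisField.finrank 2 hn, nsmul_eq_mul, mul_one] at h
    rw [h]
    have h2 : ((2 * a - 1 : ℕ) : ZMod 2) = (1 : ℕ) := by
      rw [ZMod.natCast_eq_natCast_iff']; omega
    simpa using h2
  obtain ⟨B, hB⟩ := exists_isMUB_of_forms (𝕜 := ℝ) (V := F × ZMod 2) (Z := F) (m := m)
    (by rw [Fintype.card_prod, hF, ZMod.card, hm2]) kerdockForm
    (fun z x y => by
      rw [kerdockForm_apply, kerdockForm_apply, mul_right_comm (z ^ 2)]; ring)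
    (fun z w hzw x hx => eq_zero_of_kerdockForm_eq hodd hzw hx)
    (fun z x => ⟨1, by rw [kerdockForm_self, zmodSign_zero, one_mul]⟩)
  let f : Fin (m / 2 + 1) ≃ Option F :=
    Fintype.equivOfCardEq (by rw [Fintype.card_option, hF, Fintype.card_fin, hm2]; simp)
  exact ⟨B ∘ f, hB.comp f.injective⟩

end OrthoplecticFrames

open OrthoplecticFrames
theorem mainTheorem4 :
    -- the characterization, for every maximal set of mutually unbiased bases
    (∀ (𝕜 : Type*) [RCLike 𝕜] (m l : ℕ) (S : Finset (Finset (Fin m))) (K : Type*) [Fintype K]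
      (B : K → OrthonormalBasis (Fin m) 𝕜 (EuclideanSpace 𝕜 (Fin m))),
      (∀ J ∈ S, J.card = l) → IsMUB B → (Fintype.card K : ℚ) = maxMUB 𝕜 m →
        (IsHadamardThreeDesign S →
          IsMaximalOrthoplectic (coordPacking B S) ∧ IsConstantRank (coordPacking B S) ∧
            IsFusionFrame (coordPacking B S)) ∧
        (2 < m → IsMaximalOrthoplectic (coordPacking B S) → IsConstantRank (coordPacking B S) →
          IsHadamardThreeDesign S)) ∧
    -- the complex case for powers of 2
    (∀ a m : ℕ, 2 ≤ a → m = 2 ^ a →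
      (∃ S : Finset (Finset (Fin m)), IsHadamardThreeDesign S) ∧
      ∃ B : Fin (m + 1) → OrthonormalBasis (Fin m) ℂ (EuclideanSpace ℂ (Fin m)),
        IsMUB B ∧ ∀ S : Finset (Finset (Fin m)), IsHadamardThreeDesign S →
          IsMaximalOrthoplectic (coordPacking B S) ∧ IsConstantRank (coordPacking B S) ∧
            IsFusionFrame (coordPacking B S)) ∧
    -- the real case for powers of 4
    (∀ a m : ℕ, 1 ≤ a → m = 4 ^ a →
      (∃ S : Finset (Finset (Fin m)), IsHadamardThreeDesign S) ∧
      ∃ B : Fin (m / 2 + 1) → OrthonormalBasis (Fin m) ℝ (EuclideanSpace ℝ (Fin m)),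
        IsMUB B ∧ ∀ S : Finset (Finset (Fin m)), IsHadamardThreeDesign S →
          IsMaximalOrthoplectic (coordPacking B S) ∧ IsConstantRank (coordPacking B S) ∧
            IsFusionFrame (coordPacking B S)) := by
  refine ⟨fun 𝕜 _ m l S K _ B hl hB hK =>
    ⟨fun hS => hS.isMaximalOrthoplectic hB hK, fun hm hP _ =>
      isHadamardThreeDesign_of_isMaximalOrthoplectic hl hB hK hm hP⟩,
    fun a m ha hm => ⟨exists_isHadamardThreeDesign ha hm, ?_⟩,
    fun a m ha hm => ⟨exists_isHadamardThreeDesign (n := 2 * a) (by omega)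
      (by rw [hm, pow_mul]; norm_num), ?_⟩⟩
  · obtain ⟨B, hB⟩ := exists_complex_isMUB (by omega) hm
    exact ⟨B, hB, fun S hS => hS.isMaximalOrthoplectic hB
      (by rw [maxMUB_complex, Fintype.card_fin]; push_cast; rfl)⟩
  · obtain ⟨B, hB⟩ := exists_real_isMUB ha hm
    -- Evenness identifies the truncated quotient in the index type with the rational m/2.
    have h2 : 2 ∣ m := hm ▸ dvd_pow (by norm_num) (by omega)
    exact ⟨B, hB, fun S hS => hS.isMaximalOrthoplectic hB
      (by rw [maxMUB_real, Fintype.card_fin, Nat.cast_add, Nat.cast_div h2 (by norm_num)]; simp)⟩
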